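/- **Conventions.** Let $L$ be a language consisting of relation symbols (of arities $\ge 1$) and unary function symbols, and let $\Gamma_L$ be a group of permutations of $L$ that preserve types and arities of symbols. A *$\Gamma_L$-structure* $\mathbf A$ has a vertex set $A$ (possibly empty), a relation $R_{\mathbf A}\subseteq A^{a(R)}$ for every relation symbol $R$ of arity $a(R)$, and a function $F_{\mathbf A}\colon A\to\mathcal P(A)$ for every function symbol $F$. A *homomorphism* $f\colon\mathbf A\to\mathbf B$ is a pair $(f_L,f_A)$ with $f_L\in\Gamma_L$ and $f_A\colon A\to B$ such that $\bar x\in R_{\mathbf A}$ implies $f_A(\bar x)\in f_L(R)_{\mathbf B}$, and $f_A(F_{\mathbf A}(x))\subseteq f_L(F)_{\mathbf B}(f_A(x))$. It is an *embedding* if $f_A$ is injective and these hold with "if and only if" and "$=$", respectively; an *isomorphism* is an embedding with $f_A$ bijective. Maps are composed, compared and extended both on the vertices and on the language. A *substructure* of $\mathbf A$ is the structure induced on a set of vertices closed under all functions. A structure is *irreducible* if it is not the free amalgamation of two proper substructures, i.e. it is not covered by two proper substructures $\mathbf U_1,\mathbf U_2$ such that no tuple in a relation meets both $U_1\setminus U_2$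 and $U_2\setminus U_1$. A *homomorphism-embedding* is a homomorphism whose restriction to every irreducible substructure is an embedding. A *partial automorphism* of $\mathbf A$ is an isomorphism between substructures of $\mathbf A$. A triple $(f,g,h)$ of partial automorphisms is *coherent* if $\mathrm{Dom}(f)=\mathrm{Dom}(h)$, $\mathrm{Range}(f)=\mathrm{Dom}(g)$, $\mathrm{Range}(g)=\mathrm{Range}(h)$ and $h=g\circ f$. $\mathbf B$ is an *EPPA-witness* for $\mathbf A$ if there is an embedding $\psi\colon\mathbf A\to\mathbf B$ such that every partial automorphism $f$ of $\psi(\mathbf A)$ extends to an automorphism $\hat f$ of $\mathbf B$; it is a *coherent* EPPA-witness if $\psi$ and the extensions can be chosen so that $\hat h=\hat g\circ\hat f$ for every coherent triple $(f,g,h)$. A class $\mathcal C$ of finite $\Gamma_L$-structures has (*coherent*) *EPPA* if every $\mathbf A\in\mathcal C$ has a (coherent) EPPA-witness in $\mathcal C$. It is *hereditary* if $\mathbf A\in\mathcal C$ and an embedding $\mathbf B\to\mathbf A$ imply $\mathbf B\in\mathcal C$. It has the *amalgamation property* if for all embeddings $\alpha_i\colon\mathbf A\to\mathbf B_i$ ($i=1,2$)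 with $\mathbf A,\mathbf B_1,\mathbf B_2\in\mathcal C$ there are $\mathbf C\in\mathcal C$ and embeddings $\beta_i\colon\mathbf B_i\to\mathbf C$ with $\beta_1\circ\alpha_1=\beta_2\circ\alpha_2$. An irreducible structure $\mathbf C'$ is a *completion* of $\mathbf C$ if there is a homomorphism-embedding $\mathbf C\to\mathbf C'$. It is an *automorphism-preserving* completion if moreover there are an injective homomorphism-embedding $f\colon\mathbf C\to\mathbf C'$ and a group homomorphism $\mathrm{Aut}(\mathbf C)\to\mathrm{Aut}(\mathbf C')$, $\alpha\mapsto\alpha'$, with $\alpha'\circ f=f\circ\alpha$ for all $\alpha$. Let $\mathcal E$ be a class of finite $\Gamma_L$-structures and $\mathcal K\subseteq\mathcal E$ a subclass consisting of irreducible structures. $\mathcal K$ is a *locally finite automorphism-preserving subclass* of $\mathcal E$ if for all $\mathbf A\in\mathcal K$ and $\mathbf B_0\in\mathcal E$ there is an integer $n=n(\mathbf A,\mathbf B_0)$ such that every finite $\Gamma_L$-structure $\mathbf B$ has an automorphism-preserving completion $\mathbf B'\in\mathcal K$, provided that 1. every irreducible substructure of $\mathbf B$ has an embedding to $\mathbf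 A$, 2. there is a homomorphism-embedding $\mathbf B\to\mathbf B_0$, and 3. every substructure of $\mathbf B$ on at most $n$ vertices has a completion in $\mathcal K$. **Theorem.** Let $L$ be a language consisting of relation and unary function symbols equipped with a permutation group $\Gamma_L$, and let $\mathcal E$ be a class of finite $\Gamma_L$-structures which has EPPA. Let $\mathcal K$ be a hereditary locally finite automorphism-preserving subclass of $\mathcal E$ with the amalgamation property which consists of irreducible structures. Then $\mathcal K$ has EPPA. Moreover, if $\mathcal E$ has coherent EPPA, then $\mathcal K$ has coherent EPPA. -/

import Mathlib

universe u v w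

namespace GammaL

/-- A language of relation symbols (of arities `n ≥ 1`) and unary function symbols. -/
structure Lang where
  /-- the relation symbols of arity `n` -/
  Rel : ℕ+ → Type u
  /-- the (unary) function symbols -/
  Fn : Type v

/-- The group of all permutations of the language that preserve types and arities of symbols.
A language equipped with a permutation group is a language together with a subgroup `Γ` of it. -/
abbrev Lang.SymPerm (L : Lang.{u, v}) : Type (max u v) :=
  (∀ n : ℕ+, Equiv.Perm (L.Rel n)) × Equiv.Perm L.Fn

/-- A structure: a vertex set, a relation for every relation symbol, and for every function symbol
a function from vertices to *sets* of vertices. -/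
structure Struc (L : Lang.{u, v}) where
  V : Type w
  rel : ∀ {n : ℕ+}, L.Rel n → Set (Fin n → V)
  fn : L.Fn → V → Set V

variable {L : Lang.{u, v}}

/-- A substructure of `A`, given by its vertex set: a set of vertices closed under all functions. -/
@[ext] structure Substruc (A : Struc.{u, v, w} L) where
  carrier : Set A.V
  closed : ∀ (F : L.Fn), ∀ x ∈ carrier, A.fn F x ⊆ carrier

/-- The structure that `A` induces on (the vertex set of) a substructure. -/
def Substruc.toStruc {A : Struc.{u, v, w} L} (S : Substruc A) : Struc.{u, v, w} L where
  V := S.carrier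
  rel := fun R => {x | (fun i => (x i : A.V)) ∈ A.rel R}
  fn := fun F x => {y | (y : A.V) ∈ A.fn F (x : A.V)}

/-- A homomorphism: a permutation `lang ∈ Γ` of the language together with a map of vertices. -/
@[ext] structure Hom (Γ : Subgroup L.SymPerm) (A B : Struc.{u, v, w} L) where
  lang : Γ
  toFun : A.V → B.V
  map_rel : ∀ {n : ℕ+} (R : L.Rel n) (x : Fin n → A.V),
    x ∈ A.rel R → (fun i => toFun (x i)) ∈ B.rel (lang.1.1 n R)
  map_fn : ∀ (F : L.Fn) (x : A.V), toFun '' A.fn F x ⊆ B.fn (lang.1.2 F) (toFun x)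

variable {Γ : Subgroup L.SymPerm} {A B C : Struc.{u, v, w} L}

/-- Composition of homomorphisms (both of the vertex maps and of the language permutations). -/
def Hom.comp (g : Hom Γ B C) (f : Hom Γ A B) : Hom Γ A C where
  lang := g.lang * f.lang
  toFun := fun x => g.toFun (f.toFun x)
  map_rel := fun R x hx => g.map_rel _ _ (f.map_rel R x hx)
  map_fn := by
    rintro F x _ ⟨y, hy, rfl⟩
    exact g.map_fn _ _ ⟨_, f.map_fn F x ⟨y, hy, rfl⟩, rfl⟩

/-- Restriction of a homomorphism to a substructure of its domain. -/
def Hom.restrict (f : Hom Γ A B) (S : Substruc A) : Hom Γ S.toStruc B where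
  lang := f.lang
  toFun := fun x => f.toFun x.1
  map_rel := fun R x hx => f.map_rel R (fun i => (x i).1) hx
  map_fn := by
    rintro F x _ ⟨y, hy, rfl⟩
    exact f.map_fn F x.1 ⟨y.1, hy, rfl⟩

/-- A homomorphism is an embedding if it is injective on vertices, preserves relations in both
directions, and satisfies the condition on functions with equality. -/
structure Hom.IsEmbedding (f : Hom Γ A B) : Prop where
  injective : Function.Injective f.toFun
  rel_iff : ∀ {n : ℕ+} (R : L.Rel n) (x : Fin n → A.V),
    x ∈ A.rel R ↔ (fun i => f.toFun (x i)) ∈ B.rel (f.lang.1.1 n R)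
  fn_eq : ∀ (F : L.Fn) (x : A.V), f.toFun '' A.fn F x = B.fn (f.lang.1.2 F) (f.toFun x)

/-- An isomorphism is an embedding that is surjective on vertices. -/
structure Hom.IsIsomorphism (f : Hom Γ A B) : Prop extends f.IsEmbedding where
  surjective : Function.Surjective f.toFun

/-- The image `ψ(A)` of an embedding `ψ : A → B`, which is a substructure of `B`. -/
def Hom.image (f : Hom Γ A B) (hf : f.IsEmbedding) : Substruc B where
  carrier := Set.range f.toFun
  closed := by
    rintro F _ ⟨x, rfl⟩ y hy
    have h := hf.fn_eq (f.lang.1.2.symm F) x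
    rw [Equiv.apply_symm_apply] at h
    rw [← h] at hy
    obtain ⟨z, -, rfl⟩ := hy
    exact ⟨z, rfl⟩

/-- `A` is the free amalgamation of its substructures `U₁` and `U₂` (over `U₁ ∩ U₂`): they cover
`A`, and no tuple in a relation of `A` meets both `U₁ \ U₂` and `U₂ \ U₁`. (The analogous condition
on functions is void, as functions are unary.) -/
def IsFreeAmalgamOf (A : Struc.{u, v, w} L) (U₁ U₂ : Substruc A) : Prop :=
  U₁.carrier ∪ U₂.carrier = Set.univ ∧
  ∀ {n : ℕ+} (R : L.Rel n), ∀ x ∈ A.rel R,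
    ¬ ((∃ i, x i ∈ U₁.carrier \ U₂.carrier) ∧ (∃ j, x j ∈ U₂.carrier \ U₁.carrier))

/-- A structure is irreducible if it is not the free amalgamation of two proper substructures. -/
def IsIrreducible (A : Struc.{u, v, w} L) : Prop :=
  ¬ ∃ U₁ U₂ : Substruc A,
    U₁.carrier ≠ Set.univ ∧ U₂.carrier ≠ Set.univ ∧ IsFreeAmalgamOf A U₁ U₂

/-- A homomorphism-embedding: a homomorphism whose restriction to every irreducible substructure
is an embedding. -/
def Hom.IsHomEmbedding (f : Hom Γ A B) : Prop :=
  ∀ S : Substruc A, IsIrreducible S.toStruc → (f.restrict S).IsEmbedding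

/-- The automorphism group of `A`: pairs of a language permutation in `Γ` and a permutation of the
vertices that form an isomorphism from `A` to itself. -/
def Aut (Γ : Subgroup L.SymPerm) (A : Struc.{u, v, w} L) : Subgroup (Γ × Equiv.Perm A.V) where
  carrier := {a |
    (∀ {n : ℕ+} (R : L.Rel n) (x : Fin n → A.V),
      x ∈ A.rel R ↔ (fun i => a.2 (x i)) ∈ A.rel (a.1.1.1 n R)) ∧
    (∀ (F : L.Fn) (x : A.V), a.2 '' A.fn F x = A.fn (a.1.1.2 F) (a.2 x))}
  mul_mem' := by
    rintro a b ⟨ha, ha'⟩ ⟨hb, hb'⟩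
    refine ⟨fun R x => (hb R x).trans (ha _ _), fun F x => ?_⟩
    have h := ha' (b.1.1.2 F) (b.2 x)
    rw [← hb', Set.image_image] at h
    exact h
  one_mem' := ⟨fun _ _ => Iff.rfl, fun F x => Set.image_id _⟩
  inv_mem' := by
    rintro a ⟨ha, ha'⟩
    refine ⟨fun {n} R x => ?_, fun F x => ?_⟩
    · have h := ha ((a.1.1.1 n).symm R) (fun i => a.2.symm (x i))
      simp only [Equiv.apply_symm_apply] at h
      exact h.symm
    · have h := ha' (a.1.1.2.symm F) (a.2.symm x)
      simp only [Equiv.apply_symm_apply] at h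
      rw [← h]
      change a.2.symm '' _ = A.fn (a.1.1.2.symm F) (a.2.symm x)
      rw [Set.image_image]
      simp

/-- A partial automorphism of `A`: an isomorphism between two substructures of `A`
(including its language permutation). -/
structure PartialAut (Γ : Subgroup L.SymPerm) (A : Struc.{u, v, w} L) where
  dom : Substruc A
  cod : Substruc A
  hom : Hom Γ dom.toStruc cod.toStruc
  isIso : hom.IsIsomorphism

/-- The value of a partial automorphism at a vertex of its domain, as a vertex of `A`. -/
def PartialAut.app (p : PartialAut Γ A) (x : A.V) (hx : x ∈ p.dom.carrier) : A.V :=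
  (p.hom.toFun ⟨x, hx⟩ : p.cod.carrier).1

/-- The value of a partial automorphism lies in its range. -/
theorem PartialAut.app_mem (p : PartialAut Γ A) (x : A.V) (hx : x ∈ p.dom.carrier) :
    p.app x hx ∈ p.cod.carrier :=
  (p.hom.toFun ⟨x, hx⟩ : p.cod.carrier).2

/-- The automorphism `a` of `B` extends the partial automorphism `p` of a substructure `S` of `B`
(on the vertices and on the language). -/
def Extends {S : Substruc B} (a : Aut Γ B) (p : PartialAut Γ S.toStruc) : Prop :=
  a.1.1 = p.hom.lang ∧
  ∀ (x : S.carrier) (hx : x ∈ p.dom.carrier),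
    a.1.2 x.1 = (show S.carrier from p.app x hx).1

/-- `(f, g, h)` is a coherent triple: `Dom f = Dom h`, `Range f = Dom g`, `Range g = Range h` and
`h = g ∘ f` (on the vertices and on the language). -/
def CoherentTriple (f g h : PartialAut Γ A) : Prop :=
  f.dom = h.dom ∧ g.cod = h.cod ∧ h.hom.lang = g.hom.lang * f.hom.lang ∧
  ∃ e : f.cod = g.dom, ∀ (x : A.V) (hf : x ∈ f.dom.carrier) (hh : x ∈ h.dom.carrier),
    h.app x hh = g.app (f.app x hf) (e ▸ f.app_mem x hf)

/-- `B` is an EPPA-witness for `A`: there is an embedding `ψ : A → B` such that every partial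
automorphism of `ψ(A)` extends to an automorphism of `B`. -/
def IsEPPAWitness (Γ : Subgroup L.SymPerm) (A B : Struc.{u, v, w} L) : Prop :=
  ∃ (ψ : Hom Γ A B) (hψ : ψ.IsEmbedding),
    ∀ p : PartialAut Γ (ψ.image hψ).toStruc, ∃ a : Aut Γ B, Extends a p

/-- `B` is a coherent EPPA-witness for `A`: the extensions can be chosen so that the image of every
coherent triple of partial automorphisms of `ψ(A)` is coherent. -/
def IsCoherentEPPAWitness (Γ : Subgroup L.SymPerm) (A B : Struc.{u, v, w} L) : Prop :=
  ∃ (ψ : Hom Γ A B) (hψ : ψ.IsEmbedding)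
    (φ : PartialAut Γ (ψ.image hψ).toStruc → Aut Γ B),
    (∀ p, Extends (φ p) p) ∧
    ∀ f g h, CoherentTriple f g h → φ h = φ g * φ f

/-- The extension property for partial automorphisms of a class of structures. -/
def HasEPPA (Γ : Subgroup L.SymPerm) (K : Set (Struc.{u, v, w} L)) : Prop :=
  ∀ A ∈ K, ∃ B ∈ K, IsEPPAWitness Γ A B

/-- Coherent EPPA of a class of structures. -/
def HasCoherentEPPA (Γ : Subgroup L.SymPerm) (K : Set (Struc.{u, v, w} L)) : Prop :=
  ∀ A ∈ K, ∃ B ∈ K, IsCoherentEPPAWitness Γ A B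

/-- The hereditary property. (It includes closure under isomorphisms.) -/
def IsHereditary (Γ : Subgroup L.SymPerm) (K : Set (Struc.{u, v, w} L)) : Prop :=
  ∀ A ∈ K, ∀ B : Struc.{u, v, w} L, (∃ f : Hom Γ B A, f.IsEmbedding) → B ∈ K

/-- The amalgamation property. -/
def HasAmalgamation (Γ : Subgroup L.SymPerm) (K : Set (Struc.{u, v, w} L)) : Prop :=
  ∀ A ∈ K, ∀ B₁ ∈ K, ∀ B₂ ∈ K, ∀ (α₁ : Hom Γ A B₁) (α₂ : Hom Γ A B₂),
    α₁.IsEmbedding → α₂.IsEmbedding →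
    ∃ C ∈ K, ∃ (β₁ : Hom Γ B₁ C) (β₂ : Hom Γ B₂ C),
      β₁.IsEmbedding ∧ β₂.IsEmbedding ∧ β₁.comp α₁ = β₂.comp α₂

/-- `C'` is a completion of `C`: it is irreducible and there is a homomorphism-embedding
`C → C'`. -/
def IsCompletion (Γ : Subgroup L.SymPerm) (C C' : Struc.{u, v, w} L) : Prop :=
  IsIrreducible C' ∧ ∃ f : Hom Γ C C', f.IsHomEmbedding

/-- `C'` is an automorphism-preserving completion of `C`: it is irreducible, there is an injective
homomorphism-embedding `f : C → C'`, and there is a group homomorphism `Φ : Aut C → Aut C'` such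
that `Φ a` extends `a` along `f`, that is, `Φ a ∘ f = f ∘ a`
(on the vertices and on the language). -/
def IsAutPreservingCompletion (Γ : Subgroup L.SymPerm) (C C' : Struc.{u, v, w} L) : Prop :=
  IsIrreducible C' ∧
  ∃ f : Hom Γ C C', f.IsHomEmbedding ∧ Function.Injective f.toFun ∧
    ∃ Φ : Aut Γ C →* Aut Γ C', ∀ a : Aut Γ C,
      (Φ a).1.1 * f.lang = f.lang * a.1.1 ∧
      ∀ x : C.V, (Φ a).1.2 (f.toFun x) = f.toFun (a.1.2 x)

/-- `K` is a locally finite automorphism-preserving subclass of `E`. -/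
def IsLocallyFiniteAutPreserving (Γ : Subgroup L.SymPerm) (K E : Set (Struc.{u, v, w} L)) : Prop :=
  K ⊆ E ∧
  ∀ A ∈ K, ∀ B₀ ∈ E, ∃ n : ℕ, ∀ B : Struc.{u, v, w} L, Finite B.V →
    (∀ S : Substruc B, IsIrreducible S.toStruc → ∃ f : Hom Γ S.toStruc A, f.IsEmbedding) →
    (∃ f : Hom Γ B B₀, f.IsHomEmbedding) →
    (∀ S : Substruc B, S.carrier.ncard ≤ n → ∃ C ∈ K, IsCompletion Γ S.toStruc C) →
    ∃ B' ∈ K, IsAutPreservingCompletion Γ B B'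

end GammaL

/-!
Cover an EPPA-witness `B` of `A` by charts, the substructures that embed in `A`. A point of the
cover is a point `x` of `B` together with a `ZMod 2`-flow from the image of `A` to a chart
containing `x`, where moves made through common parts containing `x` are forgotten. Thus the cover
consists of sheets, which are copies of charts, glued at `x` if their flows differ only in such
moves. An automorphism `g` of `B` lifts to the cover once a flow from the image of `A` to its
translate by `g` is chosen. If `g` extends a partial automorphism `p` of `A`, take the single move
through the range of `p`: it is forgotten at the points of this range, so that the lift still
extends `p`, and these moves add up along coherent triples. Hence the cover is again a (coherent)
EPPA-witness.

Points that pairwise lie on common sheets all lie on one sheet, so irreducible substructures of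
the cover lie on sheets. Consider a substructure `C` of the cover. If any two points of `C` over a
common chart lie on a common sheet, then a flow between two suitable sheets shows that `C` lies on
a sheet or is a free amalgam over a part of a sheet, so it has a completion in `K` by induction
and amalgamation. Otherwise the projection links two points of `C` that were not linked by an
irreducible substructure. So after sufficiently many iterations of the cover all substructures on
at most `n` vertices have completions in `K`, and local finiteness yields a completion of the
whole cover to which its automorphisms extend.
-/

namespace GammaL

open scoped Pointwise

variable {L : Lang.{u, v}} {Γ : Subgroup L.SymPerm} {A B C : Struc.{u, v, w} L}

section Morphisms

theorem Hom.IsEmbedding.comp {g : Hom Γ B C} {f : Hom Γ A B} (hg : g.IsEmbedding)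
    (hf : f.IsEmbedding) : (g.comp f).IsEmbedding where
  injective := hg.injective.comp hf.injective
  rel_iff R x := (hf.rel_iff R x).trans (hg.rel_iff _ _)
  fn_eq F x := by
    have h := hg.fn_eq (f.lang.1.2 F) (f.toFun x)
    rw [← hf.fn_eq, Set.image_image] at h
    exact h

/-- The inclusion of a substructure. -/
def Substruc.incl (Γ : Subgroup L.SymPerm) (S : Substruc A) : Hom Γ S.toStruc A where
  lang := 1
  toFun x := x.1
  map_rel _ _ hx := hx
  map_fn := by
    rintro F x _ ⟨y, hy, rfl⟩
    exact hy

theorem Substruc.incl_isEmbedding (S : Substruc A) : (S.incl Γ).IsEmbedding where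
  injective := Subtype.val_injective
  rel_iff _ _ := Iff.rfl
  fn_eq F x := ((S.incl Γ).map_fn F x).antisymm fun y hy => ⟨⟨y, S.closed F x.1 x.2 hy⟩, hy, rfl⟩

/-- A homomorphism with values in a substructure, as a homomorphism to that substructure. -/
def Hom.codRestrict (f : Hom Γ A B) (S : Substruc B) (h : ∀ x, f.toFun x ∈ S.carrier) :
    Hom Γ A S.toStruc where
  lang := f.lang
  toFun x := ⟨f.toFun x, h x⟩
  map_rel R x hx := f.map_rel R x hx
  map_fn := by
    rintro F x _ ⟨y, hy, rfl⟩
    exact f.map_fn F x ⟨y, hy, rfl⟩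

theorem Hom.IsEmbedding.codRestrict {f : Hom Γ A B} (hf : f.IsEmbedding) (S : Substruc B)
    (h : ∀ x, f.toFun x ∈ S.carrier) : (f.codRestrict S h).IsEmbedding where
  injective x y hxy := hf.injective (congrArg Subtype.val hxy)
  rel_iff R x := hf.rel_iff R x
  fn_eq F x := by
    refine ((f.codRestrict S h).map_fn F x).antisymm ?_
    rintro ⟨y, hyS⟩ hy
    obtain ⟨z, hz, rfl⟩ := (hf.fn_eq F x).superset hy
    exact ⟨z, hz, rfl⟩

/-- The preimage of a substructure under a homomorphism. -/
def Hom.comap (f : Hom Γ A B) (S : Substruc B) : Substruc A where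
  carrier := f.toFun ⁻¹' S.carrier
  closed F x hx y hy := S.closed _ _ hx (f.map_fn F x ⟨y, hy, rfl⟩)

theorem Hom.IsIsomorphism.bijective {f : Hom Γ A B} (hf : f.IsIsomorphism) :
    Function.Bijective f.toFun :=
  ⟨hf.injective, hf.surjective⟩

/-- The inverse of an isomorphism. -/
noncomputable def Hom.inverse (f : Hom Γ A B) (hf : f.IsIsomorphism) : Hom Γ B A where
  lang := f.lang⁻¹
  toFun := (Equiv.ofBijective f.toFun hf.bijective).symm
  map_rel {n} R y hy := by
    rw [hf.rel_iff]
    simp only [Equiv.ofBijective_apply_symm_apply]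
    change y ∈ B.rel (f.lang.1.1 n ((f.lang.1.1 n).symm R))
    rwa [Equiv.apply_symm_apply]
  map_fn := by
    rintro F x _ ⟨y, hy, rfl⟩
    obtain ⟨x, rfl⟩ := hf.surjective x
    have h : y ∈ B.fn (f.lang.1.2 (f.lang.1.2.symm F)) (f.toFun x) := by
      rwa [Equiv.apply_symm_apply]
    obtain ⟨z, hz, rfl⟩ := (hf.fn_eq _ x).superset h
    rw [Equiv.ofBijective_symm_apply_apply, Equiv.ofBijective_symm_apply_apply]
    exact hz

theorem Hom.inverse_apply_apply (f : Hom Γ A B) (hf : f.IsIsomorphism) (x : A.V) :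
    (f.inverse hf).toFun (f.toFun x) = x :=
  Equiv.ofBijective_symm_apply_apply f.toFun _ x

theorem Hom.apply_inverse_apply (f : Hom Γ A B) (hf : f.IsIsomorphism) (y : B.V) :
    f.toFun ((f.inverse hf).toFun y) = y :=
  Equiv.ofBijective_apply_symm_apply f.toFun _ y

theorem Hom.IsIsomorphism.inverse {f : Hom Γ A B} (hf : f.IsIsomorphism) :
    (f.inverse hf).IsIsomorphism where
  injective := Function.LeftInverse.injective (f.apply_inverse_apply hf)
  surjective := Function.RightInverse.surjective (f.inverse_apply_apply hf)
  rel_iff {n} R y := by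
    refine ⟨(f.inverse hf).map_rel R y, fun h => ?_⟩
    have h' := f.map_rel _ _ h
    simp only [f.apply_inverse_apply] at h'
    change y ∈ B.rel (f.lang.1.1 n ((f.lang.1.1 n).symm R)) at h'
    rwa [Equiv.apply_symm_apply] at h'
  fn_eq F y := by
    refine ((f.inverse hf).map_fn F y).antisymm fun x hx => ⟨f.toFun x, ?_, ?_⟩
    · have h' := f.map_fn _ _ ⟨x, hx, rfl⟩
      rw [f.apply_inverse_apply] at h'
      change f.toFun x ∈ B.fn (f.lang.1.2 (f.lang.1.2.symm F)) y at h'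
      rwa [Equiv.apply_symm_apply] at h'
    · exact f.inverse_apply_apply hf x

/-- An embedding as an isomorphism to its image. -/
def Hom.toImage (f : Hom Γ A B) (hf : f.IsEmbedding) : Hom Γ A (f.image hf).toStruc :=
  f.codRestrict (f.image hf) fun x => ⟨x, rfl⟩

theorem Hom.toImage_isIsomorphism (f : Hom Γ A B) (hf : f.IsEmbedding) :
    (f.toImage hf).IsIsomorphism where
  toIsEmbedding := hf.codRestrict _ _
  surjective := by
    rintro ⟨_, x, rfl⟩
    exact ⟨x, rfl⟩

theorem Hom.comp_inverse_toImage (f : Hom Γ A B) (hf : f.IsEmbedding) :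
    f.comp ((f.toImage hf).inverse (f.toImage_isIsomorphism hf)) = (f.image hf).incl Γ :=
  Hom.ext (mul_inv_cancel f.lang) <| funext fun y =>
    congrArg Subtype.val ((f.toImage hf).apply_inverse_apply (f.toImage_isIsomorphism hf) y)

theorem Substruc.exists_embedding_of_ne_univ {C : Substruc A} {U : Substruc C.toStruc}
    (hU : U.carrier ≠ Set.univ) :
    ∃ D : Substruc A, D.carrier ⊂ C.carrier ∧ ∃ f : Hom Γ U.toStruc D.toStruc, f.IsEmbedding := by
  have hemb := (C.incl_isEmbedding (Γ := Γ)).comp U.incl_isEmbedding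
  refine ⟨Hom.image _ hemb, ⟨?_, fun h => hU (Set.eq_univ_of_forall fun u => ?_)⟩,
    _, (Hom.toImage_isIsomorphism _ hemb).toIsEmbedding⟩
  · rintro _ ⟨u, rfl⟩
    exact u.1.2
  · obtain ⟨v, hv⟩ := h u.2
    have hvu : v.1 = u := Subtype.ext hv
    exact hvu ▸ v.2

end Morphisms

section Automorphisms

instance : MulAction (Aut Γ B) B.V :=
  MulAction.compHom B.V ((MonoidHom.snd Γ (Equiv.Perm B.V)).comp (Aut Γ B).subtype)

/-- An automorphism as a homomorphism. -/
def Aut.toHom (g : Aut Γ B) : Hom Γ B B where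
  lang := g.1.1
  toFun x := g • x
  map_rel R x hx := (g.2.1 R x).1 hx
  map_fn F x := (g.2.2 F x).subset

theorem Aut.toHom_isEmbedding (g : Aut Γ B) : (Aut.toHom g).IsEmbedding where
  injective := g.1.2.injective
  rel_iff := g.2.1
  fn_eq := g.2.2

/-- A group that acts on the language through `ρ` and on the vertices by homomorphisms acts by
automorphisms. -/
def Aut.ofAction {G : Type*} [Group G] [MulAction G B.V] (ρ : G →* Γ)
    (hrel : ∀ (g : G) {n : ℕ+} (R : L.Rel n), ∀ x ∈ B.rel R,
      (fun i => g • x i) ∈ B.rel ((ρ g).1.1 n R))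
    (hfn : ∀ (g : G) (F : L.Fn) (x : B.V), ∀ y ∈ B.fn F x, g • y ∈ B.fn ((ρ g).1.2 F) (g • x)) :
    G →* Aut Γ B where
  toFun g := ⟨(ρ g, MulAction.toPerm g), by
    refine ⟨fun {n} R x => ⟨hrel g R x, fun h => ?_⟩, fun F x => ?_⟩
    · have h' := hrel g⁻¹ _ _ h
      simp only [MulAction.toPerm_apply, inv_smul_smul, map_inv] at h'
      change x ∈ B.rel (((ρ g).1.1 n).symm ((ρ g).1.1 n R)) at h'
      rwa [Equiv.symm_apply_apply] at h'
    · refine Set.Subset.antisymm ?_ fun y hy => ⟨g⁻¹ • y, ?_, smul_inv_smul g y⟩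
      · rintro _ ⟨y, hy, rfl⟩
        exact hfn g F x y hy
      · have h' := hfn g⁻¹ _ _ _ hy
        simp only [MulAction.toPerm_apply, inv_smul_smul, map_inv] at h'
        change g⁻¹ • y ∈ B.fn ((ρ g).1.2.symm ((ρ g).1.2 F)) x at h'
        rwa [Equiv.symm_apply_apply] at h'⟩
  map_one' := Subtype.ext (Prod.ext (map_one ρ) (map_one (MulAction.toPermHom G B.V)))
  map_mul' g h := Subtype.ext (Prod.ext (map_mul ρ g h) (map_mul (MulAction.toPermHom G B.V) g h))

theorem Substruc.carrier_injective : Function.Injective (Substruc.carrier (A := A)) :=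
  fun _ _ h => Substruc.ext h

instance [Finite B.V] (S : Substruc B) : Finite S.toStruc.V :=
  inferInstanceAs (Finite S.carrier)

instance [Finite B.V] : Finite (Substruc B) :=
  Finite.of_injective _ Substruc.carrier_injective

instance : SMul (Aut Γ B) (Substruc B) where
  smul g S :=
    { carrier := g • S.carrier
      closed := fun F x hx y hy => by
        rw [Set.mem_smul_set_iff_inv_smul_mem] at hx ⊢
        exact ((Aut.toHom g⁻¹).comap S).closed F x hx hy }

instance : MulAction (Aut Γ B) (Substruc B) :=
  Substruc.carrier_injective.mulAction _ fun _ _ => rfl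

theorem Aut.exists_embedding_smul (g : Aut Γ B) (S : Substruc B) :
    ∃ f : Hom Γ (g • S).toStruc S.toStruc, f.IsEmbedding :=
  ⟨_, ((Aut.toHom_isEmbedding g⁻¹).comp (g • S).incl_isEmbedding).codRestrict S fun x =>
    Set.mem_smul_set_iff_inv_smul_mem.1 x.2⟩

end Automorphisms

section Irreducible

theorem IsFreeAmalgamOf.comap {U₁ U₂ : Substruc B} (h : IsFreeAmalgamOf B U₁ U₂)
    (f : Hom Γ A B) : IsFreeAmalgamOf A (f.comap U₁) (f.comap U₂) :=
  ⟨Set.eq_univ_of_forall fun x => h.1.superset (Set.mem_univ (f.toFun x)),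
    fun R x hx => h.2 _ _ (f.map_rel R x hx)⟩

theorem IsIrreducible.of_surjective (hA : IsIrreducible A) (f : Hom Γ A B)
    (hf : Function.Surjective f.toFun) : IsIrreducible B := by
  rintro ⟨U₁, U₂, h₁, h₂, h⟩
  have comap_ne_univ (U : Substruc B) (hU : U.carrier ≠ Set.univ) :
      (f.comap U).carrier ≠ Set.univ := by
    rwa [Hom.comap, ← Set.preimage_univ (f := f.toFun), hf.preimage_injective.ne_iff]
  exact hA ⟨_, _, comap_ne_univ U₁ h₁, comap_ne_univ U₂ h₂, h.comap f⟩

theorem IsIrreducible.image {f : Hom Γ A B} (hA : IsIrreducible A) (hf : f.IsEmbedding) :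
    IsIrreducible (f.image hf).toStruc :=
  hA.of_surjective (f.toImage hf) (f.toImage_isIsomorphism hf).surjective

theorem IsFreeAmalgamOf.subset_or_subset {U₁ U₂ W : Substruc A} (h : IsFreeAmalgamOf A U₁ U₂)
    (hW : IsIrreducible W.toStruc) : W.carrier ⊆ U₁.carrier ∨ W.carrier ⊆ U₂.carrier := by
  by_contra! hn
  have comap_ne_univ (U : Substruc A) (hU : ¬ W.carrier ⊆ U.carrier) :
      ((W.incl ⊤).comap U).carrier ≠ Set.univ :=
    fun hU' => hU fun y hy => hU'.superset (Set.mem_univ (⟨y, hy⟩ : W.carrier))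
  exact hW ⟨_, _, comap_ne_univ U₁ hn.1, comap_ne_univ U₂ hn.2, h.comap (W.incl ⊤)⟩

theorem IsFreeAmalgamOf.forall_mem_or_forall_mem {U₁ U₂ : Substruc A}
    (h : IsFreeAmalgamOf A U₁ U₂) {n : ℕ+} {R : L.Rel n} {x : Fin n → A.V} (hx : x ∈ A.rel R) :
    (∀ i, x i ∈ U₁.carrier) ∨ (∀ i, x i ∈ U₂.carrier) := by
  by_contra! hn
  obtain ⟨⟨i, hi⟩, j, hj⟩ := hn
  have cover (i) : x i ∈ U₁.carrier ∨ x i ∈ U₂.carrier := h.1.superset (Set.mem_univ (x i))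
  exact h.2 R x hx ⟨⟨j, (cover j).resolve_right hj, hj⟩, ⟨i, (cover i).resolve_left hi, hi⟩⟩

/-- The largest substructure from which the vertex `u` cannot be reached along functions. -/
def Substruc.avoiding (u : A.V) : Substruc A where
  carrier := {z | ∃ W : Substruc A, z ∈ W.carrier ∧ u ∉ W.carrier}
  closed := fun F x ⟨W, hx, hu⟩ _ hy => ⟨W, W.closed F x hx hy, hu⟩

theorem Substruc.avoiding_ne_univ (u : A.V) : (avoiding u).carrier ≠ Set.univ := fun h =>
  have ⟨_, hu, hu'⟩ := h.superset (Set.mem_univ u)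
  hu' hu

theorem Substruc.mem_of_notMem_avoiding {u z : A.V} (hz : z ∉ (avoiding u).carrier)
    {W : Substruc A} (hW : z ∈ W.carrier) : u ∈ W.carrier :=
  by_contra fun hu => hz ⟨W, hW, hu⟩

/-- If `u` and `v` lay in no common member, `A` would be the free amalgamation of the
substructures avoiding `u` and `v`. -/
theorem IsIrreducible.exists_common (hA : IsIrreducible A) (𝓕 : Set (Substruc A))
    (hv : ∀ x, ∃ W ∈ 𝓕, x ∈ W.carrier)
    (ht : ∀ {n : ℕ+} (R : L.Rel n), ∀ x ∈ A.rel R, ∃ W ∈ 𝓕, ∀ i, x i ∈ W.carrier) (u v : A.V) :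
    ∃ W ∈ 𝓕, u ∈ W.carrier ∧ v ∈ W.carrier := by
  by_contra! hn
  refine hA ⟨.avoiding u, .avoiding v, Substruc.avoiding_ne_univ u, Substruc.avoiding_ne_univ v,
    Set.eq_univ_of_forall fun z => ?_, ?_⟩
  · by_contra hz
    rw [Set.mem_union, not_or] at hz
    obtain ⟨W, hW, hzW⟩ := hv z
    exact hn W hW (Substruc.mem_of_notMem_avoiding hz.1 hzW)
      (Substruc.mem_of_notMem_avoiding hz.2 hzW)
  · rintro n R x hx ⟨⟨i, -, hi⟩, ⟨j, -, hj⟩⟩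
    obtain ⟨W, hW, hxW⟩ := ht R x hx
    exact hn W hW (Substruc.mem_of_notMem_avoiding hj (hxW j))
      (Substruc.mem_of_notMem_avoiding hi (hxW i))

/-- The substructure generated by a vertex. -/
def Substruc.closure (x : A.V) : Substruc A where
  carrier := {y | ∀ S : Substruc A, x ∈ S.carrier → y ∈ S.carrier}
  closed F y hy _ hz S hx := S.closed F y (hy S hx) hz

theorem Substruc.closure_isIrreducible (x : A.V) : IsIrreducible (closure x).toStruc := by
  rintro ⟨U₁, U₂, h₁, h₂, hcov, -⟩
  have eq_univ (U : Substruc (closure x).toStruc) (hx : ⟨x, fun _ h => h⟩ ∈ U.carrier) :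
      U.carrier = Set.univ := by
    refine Set.eq_univ_of_forall fun y => ?_
    obtain ⟨z, hz⟩ := y.2 (((closure x).incl ⊤).comp (U.incl ⊤) |>.image
      ((closure x).incl_isEmbedding.comp U.incl_isEmbedding)) ⟨⟨_, hx⟩, rfl⟩
    have hzy : z.1 = y := Subtype.ext hz
    exact hzy ▸ z.2
  exact (hcov.superset (Set.mem_univ _)).elim (fun h => h₁ (eq_univ U₁ h))
    fun h => h₂ (eq_univ U₂ h)

end Irreducible

section HomEmbedding

theorem Hom.IsHomEmbedding.comp_isEmbedding {g : Hom Γ B C} {f : Hom Γ A B}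
    (hg : g.IsHomEmbedding) (hf : f.IsEmbedding) (hA : IsIrreducible A) :
    (g.comp f).IsEmbedding := by
  have h := (hg (f.image hf) (hA.image hf)).comp (f.toImage_isIsomorphism hf).toIsEmbedding
  exact h

theorem Hom.IsHomEmbedding.comp {g : Hom Γ B C} {f : Hom Γ A B} (hg : g.IsHomEmbedding)
    (hf : f.IsHomEmbedding) : (g.comp f).IsHomEmbedding := fun S hS =>
  hg.comp_isEmbedding (hf S hS) hS

theorem Hom.IsEmbedding.isHomEmbedding {f : Hom Γ A B} (hf : f.IsEmbedding) :
    f.IsHomEmbedding := fun S _ =>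
  hf.comp S.incl_isEmbedding

theorem Hom.IsHomEmbedding.fn_eq {f : Hom Γ A B} (hf : f.IsHomEmbedding) (F : L.Fn) (x : A.V) :
    f.toFun '' A.fn F x = B.fn (f.lang.1.2 F) (f.toFun x) := by
  refine (f.map_fn F x).antisymm fun y hy => ?_
  obtain ⟨z, hz, rfl⟩ := ((hf _ (Substruc.closure_isIrreducible x)).fn_eq F
    ⟨x, fun _ h => h⟩).superset hy
  exact ⟨z.1, hz, rfl⟩

/-- The image of a homomorphism-embedding, which is a substructure. -/
def Hom.IsHomEmbedding.range {f : Hom Γ A B} (hf : f.IsHomEmbedding) : Substruc B where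
  carrier := Set.range f.toFun
  closed := by
    rintro F _ ⟨x, rfl⟩ y hy
    have h := hf.fn_eq (f.lang.1.2.symm F) x
    rw [Equiv.apply_symm_apply] at h
    obtain ⟨z, -, rfl⟩ := h.superset hy
    exact ⟨z, rfl⟩

theorem Hom.IsHomEmbedding.codRestrict {f : Hom Γ A B} (hf : f.IsHomEmbedding) (S : Substruc B)
    (h : ∀ x, f.toFun x ∈ S.carrier) : (f.codRestrict S h).IsHomEmbedding := fun W hW =>
  (hf W hW).codRestrict S fun x => h x.1

/-- Two vertices are linked if some irreducible substructure contains both. -/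
def Linked (x y : A.V) : Prop :=
  ∃ W : Substruc A, IsIrreducible W.toStruc ∧ x ∈ W.carrier ∧ y ∈ W.carrier

theorem Linked.map {x y : A.V} (h : Linked x y) {f : Hom Γ A B} (hf : f.IsHomEmbedding) :
    Linked (f.toFun x) (f.toFun y) := by
  obtain ⟨W, hW, hx, hy⟩ := h
  exact ⟨_, hW.image (hf W hW), ⟨⟨x, hx⟩, rfl⟩, ⟨⟨y, hy⟩, rfl⟩⟩

/-- The number of pairs of vertices whose images under `f` are not linked; the induction on covers
runs on this number. -/
noncomputable def Hom.defect (f : Hom Γ A B) : ℕ :=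
  {p : A.V × A.V | ¬ Linked (f.toFun p.1) (f.toFun p.2)}.ncard

theorem Hom.defect_le [Finite A.V] (f : Hom Γ A B) : f.defect ≤ Nat.card A.V ^ 2 := by
  rw [sq, ← Nat.card_prod, ← Set.ncard_univ]
  exact Set.ncard_le_ncard (Set.subset_univ _)

theorem Hom.defect_comp_lt [Finite A.V] {g : Hom Γ B C} (hg : g.IsHomEmbedding) {f : Hom Γ A B}
    {x y : A.V} (hxy : ¬ Linked (f.toFun x) (f.toFun y))
    (hgxy : Linked (g.toFun (f.toFun x)) (g.toFun (f.toFun y))) :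
    (g.comp f).defect < f.defect :=
  Set.ncard_lt_ncard ⟨fun _ hp h => hp (h.map hg), fun h => h (a := (x, y)) hxy hgxy⟩

end HomEmbedding

section Completion

variable {K : Set (Struc.{u, v, w} L)}

theorem IsFreeAmalgamOf.exists_hom {U₁ U₂ : Substruc A} (h : IsFreeAmalgamOf A U₁ U₂)
    (f₁ : Hom Γ U₁.toStruc C) (f₂ : Hom Γ U₂.toStruc C) (hlang : f₁.lang = f₂.lang)
    (hfun : ∀ x (h₁ : x ∈ U₁.carrier) (h₂ : x ∈ U₂.carrier), f₁.toFun ⟨x, h₁⟩ = f₂.toFun ⟨x, h₂⟩) :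
    ∃ f : Hom Γ A C, f.restrict U₁ = f₁ ∧ f.restrict U₂ = f₂ := by
  classical
  have cover (x) : x ∈ U₁.carrier ∨ x ∈ U₂.carrier := h.1.superset (Set.mem_univ x)
  let φ (x : A.V) : C.V :=
    if hx : x ∈ U₁.carrier then f₁.toFun ⟨x, hx⟩ else f₂.toFun ⟨x, (cover x).resolve_left hx⟩
  have hφ₁ (x : U₁.carrier) : φ x = f₁.toFun x := dif_pos x.2
  have hφ₂ (x : U₂.carrier) : φ x = f₂.toFun x := by
    by_cases hx : x.1 ∈ U₁.carrier
    · exact (dif_pos hx).trans (hfun x.1 hx x.2)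
    · exact dif_neg hx
  have map_rel {n : ℕ+} (R : L.Rel n) (x : Fin n → A.V) (hx : x ∈ A.rel R) :
      (fun i => φ (x i)) ∈ C.rel (f₁.lang.1.1 n R) := by
    rcases h.forall_mem_or_forall_mem hx with hU | hU
    · rw [funext fun i => hφ₁ ⟨x i, hU i⟩]
      exact f₁.map_rel R _ hx
    · rw [funext fun i => hφ₂ ⟨x i, hU i⟩, hlang]
      exact f₂.map_rel R _ hx
  have map_fn (F : L.Fn) (x : A.V) : φ '' A.fn F x ⊆ C.fn (f₁.lang.1.2 F) (φ x) := by
    rintro _ ⟨y, hy, rfl⟩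
    rcases cover x with hx | hx
    · rw [hφ₁ ⟨x, hx⟩, hφ₁ ⟨y, U₁.closed F x hx hy⟩]
      exact f₁.map_fn F _ ⟨_, hy, rfl⟩
    · rw [hφ₂ ⟨x, hx⟩, hφ₂ ⟨y, U₂.closed F x hx hy⟩, hlang]
      exact f₂.map_fn F _ ⟨_, hy, rfl⟩
  exact ⟨⟨f₁.lang, φ, map_rel, map_fn⟩, Hom.ext rfl (funext hφ₁), Hom.ext hlang (funext hφ₂)⟩

theorem IsFreeAmalgamOf.isHomEmbedding {U₁ U₂ : Substruc A} (h : IsFreeAmalgamOf A U₁ U₂)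
    {f : Hom Γ A C} (h₁ : (f.restrict U₁).IsHomEmbedding) (h₂ : (f.restrict U₂).IsHomEmbedding) :
    f.IsHomEmbedding := by
  have restrict_of_subset {W U : Substruc A} (hW : IsIrreducible W.toStruc)
      (hWU : W.carrier ⊆ U.carrier) (hU : (f.restrict U).IsHomEmbedding) :
      (f.restrict W).IsEmbedding :=
    hU.comp_isEmbedding ((W.incl_isEmbedding (Γ := Γ)).codRestrict U fun x => hWU x.2) hW
  exact fun W hW => (h.subset_or_subset hW).elim (restrict_of_subset hW · h₁)
    (restrict_of_subset hW · h₂)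

/-- `C` has a completion in the class `K`. -/
def HasCompletion (Γ : Subgroup L.SymPerm) (K : Set (Struc.{u, v, w} L)) (C : Struc.{u, v, w} L) :
    Prop :=
  ∃ C' ∈ K, IsCompletion Γ C C'

theorem HasCompletion.of_hom (hB : HasCompletion Γ K B) {f : Hom Γ A B} (hf : f.IsHomEmbedding) :
    HasCompletion Γ K A := by
  obtain ⟨B', hB', hirr, g, hg⟩ := hB
  exact ⟨B', hB', hirr, g.comp f, hg.comp hf⟩

theorem HasCompletion.of_freeAmalgam (hamalg : HasAmalgamation Γ K)
    (hirr : ∀ A ∈ K, IsIrreducible A) {U₁ U₂ D : Substruc A} (h : IsFreeAmalgamOf A U₁ U₂)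
    (hD : D.carrier = U₁.carrier ∩ U₂.carrier) (hDK : D.toStruc ∈ K)
    (hU₁ : HasCompletion Γ K U₁.toStruc) (hU₂ : HasCompletion Γ K U₂.toStruc) :
    HasCompletion Γ K A := by
  obtain ⟨E₁, hE₁, -, f₁, hf₁⟩ := hU₁
  obtain ⟨E₂, hE₂, -, f₂, hf₂⟩ := hU₂
  have incl_embedding {U : Substruc A} (hDU : D.carrier ⊆ U.carrier) :=
    (D.incl_isEmbedding (Γ := Γ)).codRestrict U fun x => hDU x.2
  obtain ⟨C, hC, β₁, β₂, hβ₁, hβ₂, hβ⟩ := hamalg _ hDK E₁ hE₁ E₂ hE₂ _ _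
    (hf₁.comp_isEmbedding (incl_embedding (hD.subset.trans Set.inter_subset_left)) (hirr _ hDK))
    (hf₂.comp_isEmbedding (incl_embedding (hD.subset.trans Set.inter_subset_right)) (hirr _ hDK))
  have hlang : β₁.lang * f₁.lang = β₂.lang * f₂.lang :=
    mul_right_cancel ((mul_assoc _ _ _).trans <| (congrArg Hom.lang hβ).trans
      (mul_assoc _ _ _).symm)
  obtain ⟨f, hf, hf'⟩ := h.exists_hom (β₁.comp f₁) (β₂.comp f₂) hlang fun x h₁ h₂ =>
    congrFun (congrArg Hom.toFun hβ) ⟨x, hD.superset ⟨h₁, h₂⟩⟩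
  refine ⟨C, hC, hirr C hC, f, h.isHomEmbedding ?_ ?_⟩
  · exact hf ▸ hβ₁.isHomEmbedding.comp hf₁
  · exact hf' ▸ hβ₂.isHomEmbedding.comp hf₂

/-- The substructure obtained from `S` by adjoining the vertices satisfying `P`. -/
def Substruc.adjoin (S : Substruc A) (P : A.V → Prop)
    (hP : ∀ (F : L.Fn), ∀ x ∉ S.carrier, ∀ y ∈ A.fn F x, y ∉ S.carrier → P x → P y) :
    Substruc A where
  carrier := {x | x ∈ S.carrier ∨ P x}
  closed F x hx y hy := by
    by_cases hyS : y ∈ S.carrier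
    · exact Or.inl hyS
    · have hxS : x ∉ S.carrier := fun h => hyS (S.closed F x h hy)
      exact Or.inr (hP F x hxS y hy hyS (hx.resolve_left hxS))

theorem HasCompletion.of_separation (hamalg : HasAmalgamation Γ K)
    (hirr : ∀ A ∈ K, IsIrreducible A) (S : Substruc A) (hS : S.toStruc ∈ K) (P : A.V → Prop)
    (hfn : ∀ (F : L.Fn), ∀ x ∉ S.carrier, ∀ y ∈ A.fn F x, y ∉ S.carrier → (P x ↔ P y))
    (hrel : ∀ {n : ℕ+} (R : L.Rel n), ∀ x ∈ A.rel R, ∀ i j, x i ∉ S.carrier → x j ∉ S.carrier →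
      P (x i) → P (x j))
    (hP : ∃ x ∉ S.carrier, P x) (hP' : ∃ x ∉ S.carrier, ¬ P x)
    (hproper : ∀ U : Substruc A, U.carrier ≠ Set.univ → HasCompletion Γ K U.toStruc) :
    HasCompletion Γ K A := by
  let U₁ := S.adjoin P fun F x hx y hy hyS => (hfn F x hx y hy hyS).1
  let U₂ := S.adjoin (fun x => ¬ P x) fun F x hx y hy hyS => (not_congr (hfn F x hx y hy hyS)).1
  have hU : IsFreeAmalgamOf A U₁ U₂ := by
    refine ⟨Set.eq_univ_of_forall fun x => (em (P x)).imp Or.inr Or.inr, ?_⟩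
    rintro n R x hx ⟨⟨i, -, hi⟩, ⟨j, -, hj⟩⟩
    obtain ⟨hiS, hPi⟩ := not_or.1 hi
    obtain ⟨hjS, hPj⟩ := not_or.1 hj
    exact hPj (hrel R x hx i j hiS hjS (not_not.1 hPi))
  have hinter : S.carrier = U₁.carrier ∩ U₂.carrier :=
    Set.ext fun x => ⟨fun hx => ⟨Or.inl hx, Or.inl hx⟩,
      fun ⟨h₁, h₂⟩ => h₁.elim id fun h => h₂.resolve_right (not_not.2 h)⟩
  obtain ⟨x, hxS, hx⟩ := hP
  obtain ⟨y, hyS, hy⟩ := hP'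
  exact .of_freeAmalgam hamalg hirr hU hinter hS
    (hproper U₁ fun h => not_or.2 ⟨hyS, hy⟩ (h.superset (Set.mem_univ y)))
    (hproper U₂ fun h => not_or.2 ⟨hxS, not_not.2 hx⟩ (h.superset (Set.mem_univ x)))

end Completion

section Flow

variable {V I : Type*}

/-- A `ZMod 2`-combination `c` of pairs `(D, T)` of charts. -/
abbrev Chain (I : Type*) : Type _ := I → I → ZMod 2

/-- The flow that moves from the chart `a` to the chart `b` through their common part `R`. -/
def bridge [DecidableEq I] (R a b : I) : Chain I :=
  Pi.single R (Pi.single b 1 - Pi.single a 1)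

theorem bridge_add_bridge [DecidableEq I] (R a b d : I) :
    bridge R a b + bridge R b d = bridge R a d := by
  rw [bridge, bridge, bridge, ← Pi.single_add]
  congr 1
  abel

variable [Fintype I]

/-- The chains whose row at `D` is supported on the charts containing the chart `D` and has sum
zero: a row is a set of moves between charts through their common part `D`. -/
def balancedChains (s : I → Set V) : AddSubgroup (Chain I) where
  carrier := {c | (∀ D T, ¬ s D ⊆ s T → c D T = 0) ∧ ∀ D, ∑ T, c D T = 0}
  zero_mem' := by simp
  add_mem' := by
    rintro c d ⟨hc, hc'⟩ ⟨hd, hd'⟩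
    exact ⟨fun D T h => by simp [hc D T h, hd D T h],
      fun D => by simp [Finset.sum_add_distrib, hc' D, hd' D]⟩
  neg_mem' := by
    rintro c ⟨hc, hc'⟩
    exact ⟨fun D T h => by simp [hc D T h], fun D => by simp [hc' D]⟩

variable [DecidableEq I]

/-- The chain `c` is a flow from the chart `a` to the chart `b`. -/
structure IsFlow (s : I → Set V) (a b : I) (c : Chain I) : Prop where
  mem : c ∈ balancedChains s
  boundary : ∑ D, c D = Pi.single b 1 - Pi.single a 1

variable {s : I → Set V} {a b d : I} {c c' : Chain I}

theorem IsFlow.refl (s : I → Set V) (a : I) : IsFlow s a a 0 where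
  mem := zero_mem _
  boundary := by simp

theorem IsFlow.trans (h : IsFlow s a b c) (h' : IsFlow s b d c') : IsFlow s a d (c + c') where
  mem := add_mem h.mem h'.mem
  boundary := by
    simp only [Pi.add_apply, Finset.sum_add_distrib, h.boundary, h'.boundary]
    abel

theorem IsFlow.symm (h : IsFlow s a b c) : IsFlow s b a (-c) where
  mem := neg_mem h.mem
  boundary := by
    simp only [Pi.neg_apply, Finset.sum_neg_distrib, h.boundary]
    abel

theorem single_mem_balancedChains {D : I} {f : I → ZMod 2} (hsupp : ∀ T, ¬ s D ⊆ s T → f T = 0)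
    (hsum : ∑ T, f T = 0) : Pi.single D f ∈ balancedChains s := by
  refine ⟨fun D' T hT => ?_, fun D' => ?_⟩
  · obtain rfl | hD := eq_or_ne D' D
    · rw [Pi.single_eq_same, hsupp T hT]
    · rw [Pi.single_eq_of_ne hD, Pi.zero_apply]
  · obtain rfl | hD := eq_or_ne D' D
    · rw [Pi.single_eq_same, hsum]
    · simp [hD]

theorem isFlow_bridge {R : I} (ha : s R ⊆ s a) (hb : s R ⊆ s b) : IsFlow s a b (bridge R a b) where
  mem := by
    refine single_mem_balancedChains (fun T hT => ?_) (by simp [Finset.sum_sub_distrib])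
    have hTa : T ≠ a := fun h => hT (h ▸ ha)
    have hTb : T ≠ b := fun h => hT (h ▸ hb)
    simp [hTa, hTb]
  boundary := by simp [bridge]

theorem IsFlow.mem_iff_mem (h : IsFlow s a b c) (W : Set I)
    (hW : ∀ D T T', c D T ≠ 0 → c D T' ≠ 0 → (T ∈ W ↔ T' ∈ W)) : a ∈ W ↔ b ∈ W := by
  classical
  have row_sum (D : I) : ∑ T with T ∈ W, c D T = 0 := by
    by_cases hD : ∃ T ∈ W, c D T ≠ 0
    · obtain ⟨T, hT, hDT⟩ := hD
      rw [← h.mem.2 D]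
      refine Finset.sum_subset (Finset.subset_univ _) fun T' _ hT' => ?_
      by_contra hDT'
      exact hT' (Finset.mem_filter.2 ⟨Finset.mem_univ _, (hW D T T' hDT hDT').1 hT⟩)
    · push Not at hD
      exact Finset.sum_eq_zero fun T hT => hD T (Finset.mem_filter.1 hT).2
  have hsum : ∑ T with T ∈ W, (Pi.single b 1 - Pi.single a 1 : I → ZMod 2) T = 0 := by
    rw [← h.boundary]
    simp only [Finset.sum_apply]
    rw [Finset.sum_comm]
    exact Finset.sum_eq_zero fun D _ => row_sum D
  have sum_single (i : I) :
      ∑ T with T ∈ W, (Pi.single i 1 : I → ZMod 2) T = if i ∈ W then 1 else 0 := by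
    simp [Pi.single_apply, Finset.sum_ite_eq']
  simp only [Pi.sub_apply, Finset.sum_sub_distrib, sum_single, sub_eq_zero] at hsum
  by_cases ha : a ∈ W <;> by_cases hb : b ∈ W <;> simp_all

end Flow

section Cover

variable {V I : Type*}

open scoped Classical in
/-- The chain `c` with the rows of the charts containing `x` set to zero. -/
noncomputable def offStar (s : I → Set V) (x : V) (c : Chain I) : Chain I :=
  fun D => if x ∈ s D then 0 else c D

variable {s : I → Set V} {x y : V} {D : I} {c c' : Chain I}

theorem offStar_of_mem (h : x ∈ s D) : offStar s x c D = 0 :=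
  if_pos h

theorem offStar_of_notMem (h : x ∉ s D) : offStar s x c D = c D :=
  if_neg h

theorem offStar_add (s : I → Set V) (x : V) (c c' : Chain I) :
    offStar s x (c + c') = offStar s x c + offStar s x c' := by
  funext D
  by_cases h : x ∈ s D <;> simp [offStar, h]

theorem offStar_eq_offStar_iff :
    offStar s x c = offStar s x c' ↔ ∀ D, x ∉ s D → c D = c' D := by
  refine funext_iff.trans (forall_congr' fun D => ?_)
  by_cases h : x ∈ s D <;> simp [offStar, h]

theorem offStar_offStar_of_imp (h : ∀ D, x ∈ s D → y ∈ s D) :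
    offStar s y (offStar s x c) = offStar s y c :=
  offStar_eq_offStar_iff.2 fun D hy => offStar_of_notMem fun hx => hy (h D hx)

variable [Fintype I] [DecidableEq I] {a : I}

/-- A sheet over the chart `base`, labelled by a flow that leads to this chart from `a`. -/
@[ext] structure Sheet (s : I → Set V) (a : I) where
  base : I
  chain : Chain I
  isFlow : IsFlow s a base chain

/-- The sheet over the chart `a` with the zero flow. -/
def baseSheet (s : I → Set V) (a : I) : Sheet s a :=
  ⟨a, 0, .refl s a⟩

/-- The points of the cover: the point `pt` of a sheet remembers the flow of the sheet only outside
the rows of the charts containing `pt`, so sheets are glued along these charts. -/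
@[ext] structure Cover (s : I → Set V) (a : I) where
  pt : V
  chain : Chain I
  exists_sheet : ∃ K : Sheet s a, pt ∈ s K.base ∧ chain = offStar s pt K.chain

/-- The points lying on a sheet. -/
def Sheet.points (K : Sheet s a) : Set (Cover s a) :=
  {u | u.pt ∈ s K.base ∧ u.chain = offStar s u.pt K.chain}

instance : Finite (Sheet s a) :=
  Finite.of_injective (fun K : Sheet s a => (K.base, K.chain)) fun _ _ h =>
    Sheet.ext (congrArg Prod.fst h) (congrArg Prod.snd h)

instance : Nonempty (Sheet s a) :=
  ⟨baseSheet s a⟩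

instance [Finite V] : Finite (Cover s a) :=
  Finite.of_injective (fun u : Cover s a => (u.pt, u.chain)) fun _ _ h =>
    Cover.ext (congrArg Prod.fst h) (congrArg Prod.snd h)

/-- The point of a sheet over a point of its base. -/
noncomputable def Sheet.lift (K : Sheet s a) {x : V} (hx : x ∈ s K.base) : Cover s a :=
  ⟨x, offStar s x K.chain, K, hx, rfl⟩

theorem Sheet.lift_mem_points (K : Sheet s a) {x : V} (hx : x ∈ s K.base) :
    K.lift hx ∈ K.points :=
  ⟨hx, rfl⟩

theorem Cover.exists_mem_points (u : Cover s a) : ∃ K : Sheet s a, u ∈ K.points :=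
  u.exists_sheet

theorem Sheet.injOn_pt (K : Sheet s a) : Set.InjOn Cover.pt K.points := fun u hu v hv h =>
  Cover.ext h (by rw [hu.2, hv.2, h])

theorem Sheet.chain_apply {K : Sheet s a} {u : Cover s a} (hu : u ∈ K.points)
    (hD : u.pt ∉ s D) : u.chain D = K.chain D := by
  rw [hu.2, offStar_of_notMem hD]

end Cover

section Helly

variable {V I : Type*} [Fintype I] {s : I → Set V} {c c' : Chain I}

theorem mem_balancedChains_of_forall_row (h : ∀ D, ∃ d ∈ balancedChains s, c D = d D) :
    c ∈ balancedChains s := by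
  refine ⟨fun D => ?_, fun D => ?_⟩ <;> obtain ⟨d, hd, hcd⟩ := h D <;> rw [hcd]
  · exact hd.1 D
  · exact hd.2 D

theorem sum_rows_apply_congr {x : V} {T : I} (hc : c ∈ balancedChains s)
    (hc' : c' ∈ balancedChains s) (hx : x ∉ s T) (h : ∀ D, x ∉ s D → c D = c' D) :
    (∑ D, c D) T = (∑ D, c' D) T := by
  rw [Finset.sum_apply, Finset.sum_apply]
  refine Finset.sum_congr rfl fun D _ => ?_
  by_cases hD : s D ⊆ s T
  · rw [h D fun hxD => hx (hD hxD)]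
  · rw [hc.1 D T hD, hc'.1 D T hD]

/-- Every set of points contained in some chart is contained in a smallest chart. -/
def HasHulls {V I : Type*} (s : I → Set V) : Prop :=
  ∀ Q T, Q ⊆ s T → ∃ D, Q ⊆ s D ∧ ∀ T', Q ⊆ s T' → s D ⊆ s T'

variable [DecidableEq I] {a : I}

/-- The chain is completed to a flow by a single row, at the hull of `Q`. -/
theorem HasHulls.exists_isFlow_extending (hs : HasHulls s) {Q : Set V} {c₀ : Chain I}
    (hc₀ : c₀ ∈ balancedChains s)
    (hQ : ∀ T, ¬ Q ⊆ s T → (∑ D, c₀ D) T + Pi.single (M := fun _ => ZMod 2) a 1 T = 0) :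
    ∃ b c, IsFlow s a b c ∧ Q ⊆ s b ∧ ∀ D, ¬ Q ⊆ s D → c D = c₀ D := by
  set f : I → ZMod 2 := ∑ D, c₀ D + Pi.single a 1 with hf
  have hfsum : ∑ T, f T = 1 := by
    simp only [hf, Pi.add_apply, Finset.sum_apply, Finset.sum_add_distrib]
    rw [Finset.sum_comm, Finset.sum_eq_zero fun D _ => hc₀.2 D]
    simp
  have mem_of_ne_zero (T : I) (hT : f T ≠ 0) : Q ⊆ s T := by_contra fun h => hT (hQ T h)
  obtain ⟨b, -, hb⟩ := Finset.exists_ne_zero_of_sum_ne_zero (hfsum.trans_ne one_ne_zero)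
  obtain ⟨D₁, hQD₁, hD₁⟩ := hs Q b (mem_of_ne_zero b hb)
  refine ⟨b, c₀ + Pi.single D₁ (Pi.single b 1 - f), ⟨add_mem hc₀ ?_, ?_⟩,
    mem_of_ne_zero b hb, fun D hD => ?_⟩
  · refine single_mem_balancedChains (fun T hT => ?_) (by simp [hfsum, Finset.sum_sub_distrib])
    have hQT : ¬ Q ⊆ s T := fun h => hT (hD₁ T h)
    have hTb : T ≠ b := fun h => hQT (h ▸ mem_of_ne_zero b hb)
    have hfT : f T = 0 := hQ T hQT
    simp [hTb, hfT]
  · simp only [Pi.add_apply, Finset.sum_add_distrib, Finset.sum_pi_single', hf]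
    simp only [Finset.mem_univ, if_true]
    abel
  · have hDD₁ : D ≠ D₁ := fun h => hD (h ▸ hQD₁)
    simp [hDD₁]

/-- Two points of the cover lie on a common sheet. -/
def Cover.SameSheet (u v : Cover s a) : Prop :=
  ∃ K : Sheet s a, u ∈ K.points ∧ v ∈ K.points

theorem Cover.SameSheet.chain_eq {u v : Cover s a} (h : u.SameSheet v) {D : I}
    (hu : u.pt ∉ s D) (hv : v.pt ∉ s D) : u.chain D = v.chain D := by
  obtain ⟨K, huK, hvK⟩ := h
  rw [Sheet.chain_apply huK hu, Sheet.chain_apply hvK hv]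

theorem exists_chain_of_pairwise_sameSheet {C : Set (Cover s a)}
    (hC : ∀ u ∈ C, ∀ v ∈ C, u.SameSheet v) :
    ∃ c : Chain I, (∀ u ∈ C, ∀ D, u.pt ∉ s D → c D = u.chain D) ∧
      ∀ D, (∀ u ∈ C, u.pt ∈ s D) → c D = 0 := by
  have exists_row (D : I) : ∃ r, (∀ u ∈ C, u.pt ∉ s D → r = u.chain D) ∧
      ((∀ u ∈ C, u.pt ∈ s D) → r = 0) := by
    by_cases h : ∀ u ∈ C, u.pt ∈ s D
    · exact ⟨0, fun u hu huD => absurd (h u hu) huD, fun _ => rfl⟩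
    · obtain ⟨v, hv, hvD⟩ := not_forall₂.1 h
      exact ⟨v.chain D, fun u hu huD => (hC v hv u hu).chain_eq hvD huD, fun h' => absurd h' h⟩
  choose c hc hc' using exists_row
  exact ⟨c, fun u hu D => hc D u hu, hc'⟩

theorem HasHulls.exists_sheet_of_pairwise (hs : HasHulls s) {C : Set (Cover s a)}
    (hC : ∀ u ∈ C, ∀ v ∈ C, u.SameSheet v) : ∃ K : Sheet s a, C ⊆ K.points := by
  obtain ⟨c₀, hc₀, hc₀'⟩ := exists_chain_of_pairwise_sameSheet hC
  have eq_sheet {u} (hu : u ∈ C) {K : Sheet s a} (hK : u ∈ K.points) (D : I) (hD : u.pt ∉ s D) :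
      c₀ D = K.chain D := by
    rw [hc₀ u hu D hD, Sheet.chain_apply hK hD]
  have hmem : c₀ ∈ balancedChains s := mem_balancedChains_of_forall_row fun D => by
    by_cases h : ∀ u ∈ C, u.pt ∈ s D
    · exact ⟨0, zero_mem _, hc₀' D h⟩
    · obtain ⟨u, hu, huD⟩ := not_forall₂.1 h
      obtain ⟨K, hK⟩ := u.exists_mem_points
      exact ⟨K.chain, K.isFlow.mem, eq_sheet hu hK D huD⟩
  obtain ⟨b, c, hbc, hCb, hcc₀⟩ := hs.exists_isFlow_extending (a := a) (Q := Cover.pt '' C) hmem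
    fun T hT => by
      obtain ⟨_, ⟨u, hu, rfl⟩, huT⟩ := Set.not_subset.1 hT
      obtain ⟨K, hK⟩ := u.exists_mem_points
      have hTK : T ≠ K.base := fun h => huT (h ▸ hK.1)
      rw [sum_rows_apply_congr hmem K.isFlow.mem huT (eq_sheet hu hK), K.isFlow.boundary,
        Pi.sub_apply, sub_add_cancel, Pi.single_eq_of_ne hTK]
  refine ⟨⟨b, c, hbc⟩, fun u hu => ⟨hCb ⟨u, hu, rfl⟩, ?_⟩⟩
  obtain ⟨K, hK⟩ := u.exists_mem_points
  rw [hK.2]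
  refine offStar_eq_offStar_iff.2 fun D hD => ?_
  rw [← eq_sheet hu hK D hD]
  exact (hcc₀ D fun h => hD (h ⟨u, hu, rfl⟩)).symm

end Helly

section Separation

variable {V I : Type*} [Fintype I] [DecidableEq I] {s : I → Set V} {a : I}

/-- Points of `C` that are projected to a common chart lie on a common sheet. -/
def IsReflecting (C : Set (Cover s a)) : Prop :=
  ∀ u ∈ C, ∀ v ∈ C, ∀ T, u.pt ∈ s T → v.pt ∈ s T → u.SameSheet v

theorem IsReflecting.exists_sheet (hs : HasHulls s) {C : Set (Cover s a)} (hC : IsReflecting C)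
    (T : I) : ∃ K : Sheet s a, {u ∈ C | u.pt ∈ s T} ⊆ K.points :=
  hs.exists_sheet_of_pairwise fun u hu v hv => hC u hu.1 v hv.1 T hu.2 hv.2

theorem exists_extremal_sheets {C : Set (Cover s a)} (hC : ¬ ∃ K : Sheet s a, C ⊆ K.points) :
    ∃ K₁ K₂ : Sheet s a, (∀ K : Sheet s a, (C ∩ K.points).ncard ≤ (C ∩ K₁.points).ncard) ∧
      ¬ C ∩ K₂.points ⊆ K₁.points ∧
      ∀ K : Sheet s a, ¬ C ∩ K.points ⊆ K₁.points →
        (C ∩ (K₁.points ∩ K.points)).ncard ≤ (C ∩ (K₁.points ∩ K₂.points)).ncard := by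
  obtain ⟨K₁, hK₁⟩ := Finite.exists_max fun K : Sheet s a => (C ∩ K.points).ncard
  obtain ⟨u, hu, huK₁⟩ := Set.not_subset.1 (not_exists.1 hC K₁)
  obtain ⟨K, hK⟩ := u.exists_mem_points
  obtain ⟨K₂, hK₂, hmax⟩ := Set.exists_max_image {K : Sheet s a | ¬ C ∩ K.points ⊆ K₁.points}
    (fun K => (C ∩ (K₁.points ∩ K.points)).ncard) (Set.toFinite _)
    ⟨K, fun h => huK₁ (h ⟨hu, hK⟩)⟩
  exact ⟨K₁, K₂, hK₁, hK₂, hmax⟩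

/-- `W` is the set of charts over which `C` is contained in the first of two extremal sheets. -/
theorem IsReflecting.exists_cut (hs : HasHulls s) {C : Set (Cover s a)} (hC : IsReflecting C)
    (hfin : C.Finite) (hne : ¬ ∃ K : Sheet s a, C ⊆ K.points) :
    ∃ (K₁ K₂ : Sheet s a) (W : Set I),
      (¬ C ∩ K₁.points ⊆ K₂.points ∧ ¬ C ∩ K₂.points ⊆ K₁.points) ∧
      (K₁.base ∈ W ∧ K₂.base ∉ W) ∧
      ∀ D, Cover.pt '' (C ∩ (K₁.points ∩ K₂.points)) ⊆ s D →
        (∃ w ∈ C, w ∉ K₁.points ∩ K₂.points ∧ w.pt ∈ s D) →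
        ∀ T T', s D ⊆ s T → s D ⊆ s T' → T ∈ W → T' ∈ W := by
  obtain ⟨K₁, K₂, hmax₁, hK₂, hmax₂⟩ := exists_extremal_sheets hne
  have subset_over (K : Sheet s a) : C ∩ K.points ⊆ {u ∈ C | u.pt ∈ s K.base} :=
    fun u hu => ⟨hu.1, hu.2.1⟩
  refine ⟨K₁, K₂, {T | {u ∈ C | u.pt ∈ s T} ⊆ K₁.points}, ⟨fun h => ?_, hK₂⟩, ⟨?_, ?_⟩, ?_⟩
  · have hlt : C ∩ K₁.points ⊂ C ∩ K₂.points :=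
      ⟨Set.subset_inter Set.inter_subset_left h, fun h' => hK₂ (h'.trans Set.inter_subset_right)⟩
    exact (hmax₁ K₂).not_gt (Set.ncard_lt_ncard hlt (hfin.inter_of_left _))
  · obtain ⟨K, hK⟩ := hC.exists_sheet hs K₁.base
    have heq : C ∩ K₁.points = C ∩ K.points := Set.eq_of_subset_of_ncard_le
      (Set.subset_inter Set.inter_subset_left ((subset_over K₁).trans hK)) (hmax₁ K)
      (hfin.inter_of_left _)
    exact fun u hu => (heq.superset ⟨hu.1, hK hu⟩).2
  · exact fun h => hK₂ ((subset_over K₂).trans h)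
  · rintro D hND ⟨w, hw, hwN, hwD⟩ T T' hT hT' hTW u hu
    obtain ⟨K, hK⟩ := hC.exists_sheet hs T'
    have hlt : C ∩ (K₁.points ∩ K₂.points) ⊂ C ∩ (K₁.points ∩ K.points) := by
      refine ⟨fun v hv => ⟨hv.1, hv.2.1, hK ⟨hv.1, hT' (hND ⟨v, hv, rfl⟩)⟩⟩, fun h => ?_⟩
      exact hwN (h ⟨hw, hTW ⟨hw, hT hwD⟩, hK ⟨hw, hT' hwD⟩⟩).2
    by_contra huK₁
    refine (hmax₂ K fun h => huK₁ (h ⟨hu.1, hK hu⟩)).not_gt ?_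
    exact Set.ncard_lt_ncard hlt (hfin.inter_of_left _)

/-- Outside `K₁ ∩ K₂`, the predicate `P` tells whether a point has the same chain as `K₁` in the
rows of the charts that contain no projection of a point of `C` outside `K₁ ∩ K₂`. If it did not
distinguish `K₁` from `K₂`, the flow between these sheets would not leave the set `W` of the cut. -/
theorem IsReflecting.exists_separation (hs : HasHulls s) {C : Set (Cover s a)}
    (hC : IsReflecting C) (hfin : C.Finite) (hne : ¬ ∃ K : Sheet s a, C ⊆ K.points) :
    ∃ (K₁ K₂ : Sheet s a) (P : Cover s a → Prop),
      (∃ u ∈ C, u ∉ K₁.points ∩ K₂.points ∧ P u) ∧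
      (∃ u ∈ C, u ∉ K₁.points ∩ K₂.points ∧ ¬ P u) ∧
      ∀ u ∈ C, u ∉ K₁.points ∩ K₂.points → ∀ v ∈ C, v ∉ K₁.points ∩ K₂.points →
        u.SameSheet v → P u → P v := by
  obtain ⟨K₁, K₂, W, ⟨hK₁, hK₂⟩, ⟨hW₁, hW₂⟩, hcut⟩ := hC.exists_cut hs hfin hne
  obtain ⟨u, hu, huK₂⟩ := Set.not_subset.1 hK₁
  obtain ⟨v, hv, hvK₁⟩ := Set.not_subset.1 hK₂
  let free : Set I := {D | ∀ w ∈ C, w ∉ K₁.points ∩ K₂.points → w.pt ∉ s D}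
  refine ⟨K₁, K₂, fun w => ∀ D ∈ free, w.chain D = K₁.chain D,
    ⟨u, hu.1, fun h => huK₂ h.2, fun D hD => ?_⟩, ⟨v, hv.1, fun h => hvK₁ h.1, fun hPv => ?_⟩, ?_⟩
  · exact Sheet.chain_apply hu.2 (hD u hu.1 fun h => huK₂ h.2)
  · have hflow := K₁.isFlow.symm.trans K₂.isFlow
    have row_eq_zero (D) (h : K₁.chain D = K₂.chain D) : (-K₁.chain + K₂.chain) D = 0 := by
      rw [Pi.add_apply, Pi.neg_apply, h, neg_add_cancel]
    refine hW₂ ((hflow.mem_iff_mem W fun D T T' hT hT' => ?_).1 hW₁)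
    have hDT : s D ⊆ s T := by_contra fun h => hT (hflow.mem.1 D T h)
    have hDT' : s D ⊆ s T' := by_contra fun h => hT' (hflow.mem.1 D T' h)
    by_cases hND : Cover.pt '' (C ∩ (K₁.points ∩ K₂.points)) ⊆ s D
    · by_cases hD : D ∈ free
      · refine absurd (congrFun (row_eq_zero D ?_) T) hT
        rw [← hPv D hD, Sheet.chain_apply hv.2 (hD v hv.1 fun h => hvK₁ h.1)]
      · have ⟨w, hw, hwN, hwD⟩ : ∃ w ∈ C, w ∉ K₁.points ∩ K₂.points ∧ w.pt ∈ s D := by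
          simpa [free] using hD
        have hDW := hcut D hND ⟨w, hw, hwN, hwD⟩
        exact ⟨hDW T T' hDT hDT', hDW T' T hDT' hDT⟩
    · obtain ⟨_, ⟨w, hw, rfl⟩, hwD⟩ := Set.not_subset.1 hND
      refine absurd (congrFun (row_eq_zero D ?_) T) hT
      rw [← Sheet.chain_apply hw.2.1 hwD, Sheet.chain_apply hw.2.2 hwD]
  · intro x hx hxN y hy hyN hxy hPx D hD
    rw [← hPx D hD, hxy.chain_eq (hD x hx hxN) (hD y hy hyN)]

end Separation

section Lift

variable {V I G : Type*} [Group G] [MulAction G V] [MulAction G I]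

/-- A family of sets indexed equivariantly. -/
class EquivariantFamily (G : Type*) {V I : Type*} [Group G] [MulAction G V] [MulAction G I]
    (s : I → Set V) : Prop where
  smul_mem_smul_iff : ∀ (g : G) (x : V) (D : I), g • x ∈ s (g • D) ↔ x ∈ s D

/-- The action of `g` on chains. -/
def translate (g : G) : Chain I →+ Chain I where
  toFun c D T := c (g⁻¹ • D) (g⁻¹ • T)
  map_zero' := rfl
  map_add' _ _ := rfl

theorem translate_one (c : Chain I) : translate (1 : G) c = c := by
  funext D T
  simp [translate]

theorem translate_mul (g h : G) (c : Chain I) :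
    translate (g * h) c = translate g (translate h c) := by
  funext D T
  simp [translate, mul_smul]

theorem translate_single [DecidableEq I] (g : G) (D : I) (f : I → ZMod 2) :
    translate g (Pi.single D f) = Pi.single (g • D) fun T => f (g⁻¹ • T) := by
  funext D' T
  change (Pi.single D f : Chain I) (g⁻¹ • D') (g⁻¹ • T) = _
  obtain rfl | hD := eq_or_ne D' (g • D)
  · rw [inv_smul_smul, Pi.single_eq_same, Pi.single_eq_same]
  · rw [Pi.single_eq_of_ne hD, Pi.single_eq_of_ne (fun h => hD (inv_smul_eq_iff.1 h))]
    rfl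

theorem single_inv_smul [DecidableEq I] (g : G) (a T : I) :
    (Pi.single a 1 : I → ZMod 2) (g⁻¹ • T) = (Pi.single (g • a) 1 : I → ZMod 2) T := by
  simp only [Pi.single_apply, inv_smul_eq_iff]

theorem translate_bridge [DecidableEq I] (g : G) (R a b : I) :
    translate g (bridge R a b) = bridge (g • R) (g • a) (g • b) := by
  rw [bridge, translate_single, bridge]
  congr 1
  funext T
  simp only [Pi.sub_apply, single_inv_smul]

variable {s : I → Set V} [EquivariantFamily G s]

theorem smul_mem_apply_iff (g : G) {x : V} {D : I} : g • x ∈ s D ↔ x ∈ s (g⁻¹ • D) := by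
  rw [← EquivariantFamily.smul_mem_smul_iff g x (g⁻¹ • D), smul_inv_smul]

theorem smul_subset_smul_iff (g : G) {D T : I} : s (g • D) ⊆ s (g • T) ↔ s D ⊆ s T := by
  refine ⟨fun h x hx => ?_, fun h x hx => ?_⟩
  · rw [← EquivariantFamily.smul_mem_smul_iff g] at hx ⊢
    exact h hx
  · rw [← smul_inv_smul g x, EquivariantFamily.smul_mem_smul_iff] at hx ⊢
    exact h hx

theorem translate_offStar (g : G) (x : V) (c : Chain I) :
    translate g (offStar s x c) = offStar s (g • x) (translate g c) := by
  funext D T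
  change offStar s x c (g⁻¹ • D) (g⁻¹ • T) = _
  by_cases h : x ∈ s (g⁻¹ • D)
  · rw [offStar_of_mem h, offStar_of_mem ((smul_mem_apply_iff g).2 h)]
    rfl
  · rw [offStar_of_notMem h, offStar_of_notMem fun h' => h ((smul_mem_apply_iff g).1 h')]
    rfl

variable [Fintype I]

theorem translate_mem_balancedChains (g : G) {c : Chain I} (hc : c ∈ balancedChains s) :
    translate g c ∈ balancedChains s := by
  refine ⟨fun D T h => hc.1 _ _ fun h' => h ?_, fun D => ?_⟩
  · exact (smul_subset_smul_iff g⁻¹).1 h'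
  · rw [← hc.2 (g⁻¹ • D)]
    exact Equiv.sum_comp (MulAction.toPerm g⁻¹) (c (g⁻¹ • D))

variable [DecidableEq I] {a b : I}

theorem IsFlow.translate {c : Chain I} (h : IsFlow s a b c) (g : G) :
    IsFlow s (g • a) (g • b) (translate g c) where
  mem := translate_mem_balancedChains g h.mem
  boundary := by
    funext T
    have hT := congrFun h.boundary (g⁻¹ • T)
    rw [Finset.sum_apply, ← Equiv.sum_comp (MulAction.toPerm g⁻¹), Pi.sub_apply,
      single_inv_smul, single_inv_smul] at hT
    rw [Finset.sum_apply]
    exact hT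

/-- A lift of the symmetry `base` to the cover: `shift` is a flow that leads from the chart `a`
back to its image. -/
@[ext] structure Lift (G : Type*) {V I : Type*} [Group G] [MulAction G I] [Fintype I]
    [DecidableEq I] (s : I → Set V) (a : I) where
  base : G
  shift : Chain I
  isFlow : IsFlow s a (base • a) shift

instance : Group (Lift G s a) where
  mul l m := ⟨l.base * m.base, l.shift + translate l.base m.shift,
    mul_smul l.base m.base a ▸ l.isFlow.trans (m.isFlow.translate l.base)⟩
  one := ⟨1, 0, (one_smul G a).symm ▸ .refl s a⟩
  inv l := ⟨l.base⁻¹, -translate l.base⁻¹ l.shift, by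
    simpa only [inv_smul_smul] using (l.isFlow.translate l.base⁻¹).symm⟩
  mul_assoc l m n := Lift.ext (mul_assoc _ _ _) <| by
    change _ + _ + translate (l.base * m.base) _ = _ + translate _ (_ + _)
    rw [map_add, translate_mul, add_assoc]
  one_mul l := Lift.ext (one_mul _) <| by
    change 0 + translate 1 l.shift = l.shift
    rw [translate_one, zero_add]
  mul_one l := Lift.ext (mul_one _) <| by
    change l.shift + translate l.base 0 = l.shift
    rw [map_zero, add_zero]
  inv_mul_cancel l := Lift.ext (inv_mul_cancel _) (neg_add_cancel _)

/-- The symmetry lifted by a lift. -/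
def Lift.baseHom : Lift G s a →* G where
  toFun := Lift.base
  map_one' := rfl
  map_mul' _ _ := rfl

instance : SMul (Lift G s a) (Sheet s a) where
  smul l K := ⟨l.base • K.base, l.shift + translate l.base K.chain,
    l.isFlow.trans (K.isFlow.translate l.base)⟩

theorem offStar_add_translate (l : Lift G s a) (x : V) (c : Chain I) :
    offStar s (l.base • x) (l.shift + translate l.base (offStar s x c)) =
      offStar s (l.base • x) (l.shift + translate l.base c) := by
  rw [translate_offStar, offStar_add, offStar_add, offStar_offStar_of_imp fun _ => id]

noncomputable instance : SMul (Lift G s a) (Cover s a) where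
  smul l u := ⟨l.base • u.pt, offStar s (l.base • u.pt) (l.shift + translate l.base u.chain), by
    obtain ⟨K, hK, hu⟩ := u.exists_sheet
    refine ⟨l • K, (EquivariantFamily.smul_mem_smul_iff _ _ _).2 hK, ?_⟩
    rw [hu, offStar_add_translate]
    rfl⟩

theorem Sheet.smul_mem_points (l : Lift G s a) {K : Sheet s a} {u : Cover s a}
    (hu : u ∈ K.points) : l • u ∈ (l • K).points := by
  refine ⟨(EquivariantFamily.smul_mem_smul_iff _ _ _).2 hu.1, ?_⟩
  change offStar s _ (_ + translate _ u.chain) = _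
  rw [hu.2, offStar_add_translate]
  rfl

noncomputable instance : MulAction (Lift G s a) (Cover s a) where
  one_smul u := Cover.ext (one_smul G u.pt) <| by
    obtain ⟨K, -, hu⟩ := u.exists_sheet
    change offStar s ((1 : G) • u.pt) (0 + translate (1 : G) u.chain) = u.chain
    rw [one_smul, translate_one, zero_add, hu, offStar_offStar_of_imp fun _ => id]
  mul_smul l m u := Cover.ext (mul_smul l.base m.base u.pt) <| by
    change offStar s ((l.base * m.base) • u.pt) (l.shift + translate l.base m.shift +
        translate (l.base * m.base) u.chain) =
      offStar s (l.base • m.base • u.pt) (l.shift + translate l.base (offStar s (m.base • u.pt)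
        (m.shift + translate m.base u.chain)))
    rw [offStar_add_translate, translate_mul, mul_smul, map_add, add_assoc]

end Lift

section CoverStructure

variable {I : Type w} [Fintype I] [DecidableEq I]

/-- The vertex sets of a family of substructures. -/
abbrev carriers (s : I → Substruc B) : I → Set B.V :=
  fun i => (s i).carrier

/-- The structure on the points of the cover that makes every sheet an isomorphic copy of the
chart below it and has no tuples in relations beyond those on sheets. -/
def coverStruc (s : I → Substruc B) (a : I) : Struc.{u, v, w} L where
  V := Cover (carriers s) a
  rel R := {x | (fun i => (x i).pt) ∈ B.rel R ∧ ∃ K : Sheet (carriers s) a, ∀ i, x i ∈ K.points}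
  fn F u := {v | v.pt ∈ B.fn F u.pt ∧ v.chain = offStar (carriers s) v.pt u.chain}

variable {s : I → Substruc B} {a : I}

instance [Finite B.V] : Finite (coverStruc s a).V :=
  inferInstanceAs (Finite (Cover (carriers s) a))

theorem Sheet.mem_fn_iff {K : Sheet (carriers s) a} {u v : (coverStruc s a).V} {F : L.Fn}
    (hu : u ∈ K.points) :
    v ∈ (coverStruc s a).fn F u ↔ v.pt ∈ B.fn F u.pt ∧ v ∈ K.points := by
  refine and_congr_right fun hv => ?_
  have hoff : offStar (carriers s) v.pt u.chain = offStar (carriers s) v.pt K.chain := by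
    rw [hu.2, offStar_offStar_of_imp fun D hD => (s D).closed F _ hD hv]
  exact ⟨fun h => ⟨(s K.base).closed F _ hu.1 hv, h.trans hoff⟩, fun h => h.2.trans hoff.symm⟩

/-- A sheet as a substructure of the cover. -/
def Sheet.substruc (K : Sheet (carriers s) a) : Substruc (coverStruc s a) where
  carrier := K.points
  closed _ _ hu _ hv := ((K.mem_fn_iff hu).1 hv).2

/-- The projection of the cover. -/
def coverProj (Γ : Subgroup L.SymPerm) (s : I → Substruc B) (a : I) :
    Hom Γ (coverStruc s a) B where
  lang := 1
  toFun := Cover.pt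
  map_rel _ _ hx := hx.1
  map_fn := by
    rintro F u _ ⟨v, hv, rfl⟩
    exact hv.1

theorem Sheet.coverProj_restrict_isEmbedding (K : Sheet (carriers s) a) :
    ((coverProj Γ s a).restrict K.substruc).IsEmbedding where
  injective u v h := Subtype.ext (K.injOn_pt u.2 v.2 h)
  rel_iff R x := ⟨fun h => h.1, fun h => ⟨h, K, fun i => (x i).2⟩⟩
  fn_eq F u := by
    refine Set.Subset.antisymm (((coverProj Γ s a).restrict K.substruc).map_fn F u) fun y hy => ?_
    have hyK : y ∈ (s K.base).carrier := (s K.base).closed F _ u.2.1 hy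
    exact ⟨⟨K.lift hyK, K.lift_mem_points hyK⟩,
      (K.mem_fn_iff u.2).2 ⟨hy, K.lift_mem_points hyK⟩, rfl⟩

theorem Sheet.coverProj_comp_isEmbedding (K : Sheet (carriers s) a) {f : Hom Γ A (coverStruc s a)}
    (hf : f.IsEmbedding) (hK : ∀ x, f.toFun x ∈ K.points) :
    ((coverProj Γ s a).comp f).IsEmbedding :=
  K.coverProj_restrict_isEmbedding.comp (hf.codRestrict K.substruc hK)

theorem Sheet.exists_embedding (K : Sheet (carriers s) a) {f : Hom Γ A (coverStruc s a)}
    (hf : f.IsEmbedding) (hK : ∀ x, f.toFun x ∈ K.points) :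
    ∃ g : Hom Γ A (s K.base).toStruc, g.IsEmbedding :=
  ⟨_, (K.coverProj_comp_isEmbedding hf hK).codRestrict (s K.base) fun x => (hK x).1⟩

theorem IsIrreducible.exists_sheet (hs : HasHulls (carriers s)) {W : Substruc (coverStruc s a)}
    (hW : IsIrreducible W.toStruc) : ∃ K : Sheet (carriers s) a, W.carrier ⊆ K.points := by
  refine hs.exists_sheet_of_pairwise fun u hu v hv => ?_
  obtain ⟨_, ⟨K, rfl⟩, huK, hvK⟩ := hW.exists_common
    (Set.range fun K : Sheet (carriers s) a => (W.incl ⊤).comap K.substruc)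
    (fun x => have ⟨K, hK⟩ := Cover.exists_mem_points x.1; ⟨_, ⟨K, rfl⟩, hK⟩)
    (fun _ _ hx => have ⟨K, hK⟩ := hx.2; ⟨_, ⟨K, rfl⟩, hK⟩) ⟨u, hu⟩ ⟨v, hv⟩
  exact ⟨K, huK, hvK⟩

theorem coverProj_isHomEmbedding (hs : HasHulls (carriers s)) :
    (coverProj Γ s a).IsHomEmbedding := fun W hW =>
  have ⟨K, hK⟩ := hW.exists_sheet hs
  K.coverProj_comp_isEmbedding W.incl_isEmbedding fun x => hK x.2

/-- The action of the lifts of automorphisms on the cover. -/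
noncomputable def liftAut [MulAction (Aut Γ B) I] [EquivariantFamily (Aut Γ B) (carriers s)] :
    Lift (Aut Γ B) (carriers s) a →* Aut Γ (coverStruc s a) :=
  letI : MulAction (Lift (Aut Γ B) (carriers s) a) (coverStruc s a).V :=
    inferInstanceAs (MulAction _ (Cover (carriers s) a))
  Aut.ofAction ((MonoidHom.fst Γ _).comp ((Aut Γ B).subtype.comp Lift.baseHom))
    (fun l _ R x ⟨hx, K, hK⟩ =>
      ⟨(Aut.toHom l.base).map_rel R _ hx, l • K, fun i => Sheet.smul_mem_points l (hK i)⟩)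
    (fun l F u v hv => by
      obtain ⟨K, hu⟩ := Cover.exists_mem_points u
      obtain ⟨hv, hvK⟩ := (K.mem_fn_iff hu).1 hv
      exact (Sheet.mem_fn_iff (Sheet.smul_mem_points l hu)).2
        ⟨(Aut.toHom l.base).map_fn F _ ⟨_, hv, rfl⟩, Sheet.smul_mem_points l hvK⟩)

variable {K : Set (Struc.{u, v, w} L)}

/-- A reflecting substructure is a tree-like free amalgam of pieces of charts. -/
theorem IsReflecting.hasCompletion [Finite B.V] (hher : IsHereditary Γ K)
    (hamalg : HasAmalgamation Γ K) (hirr : ∀ A ∈ K, IsIrreducible A) (hs : HasHulls (carriers s))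
    (hsK : ∀ i, (s i).toStruc ∈ K) {C : Substruc (coverStruc s a)} (hC : IsReflecting C.carrier) :
    HasCompletion Γ K C.toStruc := by
  induction hn : C.carrier.ncard using Nat.strong_induction_on generalizing C with
  | _ n ih =>
  subst hn
  by_cases hsheet : ∃ K : Sheet (carriers s) a, C.carrier ⊆ K.points
  · obtain ⟨K₀, hK₀⟩ := hsheet
    obtain ⟨g, hg⟩ := K₀.exists_embedding (C.incl_isEmbedding (Γ := Γ)) fun x => hK₀ x.2
    exact ⟨_, hsK K₀.base, hirr _ (hsK K₀.base), g, hg.isHomEmbedding⟩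
  obtain ⟨K₁, K₂, P, ⟨x, hxC, hx, hPx⟩, ⟨y, hyC, hy, hPy⟩, hP⟩ :=
    hC.exists_separation hs (Set.toFinite C.carrier) hsheet
  let S : Substruc C.toStruc :=
    { carrier := {u | u.1 ∈ K₁.points ∩ K₂.points}
      closed := fun F u hu v hv =>
        ⟨K₁.substruc.closed F u.1 hu.1 hv, K₂.substruc.closed F u.1 hu.2 hv⟩ }
  have hSK : S.toStruc ∈ K := hher _ (hsK K₁.base) _ <| K₁.exists_embedding
    (C.incl_isEmbedding.comp (S.incl_isEmbedding (Γ := Γ))) fun u => u.2.1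
  refine .of_separation hamalg hirr S hSK (fun u => P u.1) (fun F u hu v hv hvS => ?_)
    (fun R z hz i j hi hj => ?_) ⟨⟨x, hxC⟩, hx, hPx⟩ ⟨⟨y, hyC⟩, hy, hPy⟩ fun U hU => ?_
  · obtain ⟨K₀, hu₀⟩ := Cover.exists_mem_points u.1
    have hv₀ := K₀.substruc.closed F u.1 hu₀ hv
    exact ⟨hP u.1 u.2 hu v.1 v.2 hvS ⟨K₀, hu₀, hv₀⟩, hP v.1 v.2 hvS u.1 u.2 hu ⟨K₀, hv₀, hu₀⟩⟩
  · obtain ⟨-, K₀, hK₀⟩ := hz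
    exact hP _ (z i).2 hi _ (z j).2 hj ⟨K₀, hK₀ i, hK₀ j⟩
  · obtain ⟨D, hD, f, hf⟩ := Substruc.exists_embedding_of_ne_univ (Γ := Γ) hU
    exact (ih _ (Set.ncard_lt_ncard hD) (C := D) (fun u hu v hv => hC u (hD.1 hu) v (hD.1 hv))
      rfl).of_hom hf.isHomEmbedding

end CoverStructure

section Extensions

theorem PartialAut.exists_app (p : PartialAut Γ A) {y : A.V} (hy : y ∈ p.cod.carrier) :
    ∃ (x : A.V) (hx : x ∈ p.dom.carrier), p.app x hx = y := by
  obtain ⟨x, hx⟩ := p.isIso.surjective ⟨y, hy⟩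
  exact ⟨x.1, x.2, congrArg Subtype.val hx⟩

/-- The automorphism `g` of `B` extends the partial automorphism `p` of `A` along `ι : A → B`
(on the vertices and on the language). -/
def ExtendsAlong (ι : Hom Γ A B) (g : Aut Γ B) (p : PartialAut Γ A) : Prop :=
  g.1.1 * ι.lang = ι.lang * p.hom.lang ∧
    ∀ (x : A.V) (hx : x ∈ p.dom.carrier), g • ι.toFun x = ι.toFun (p.app x hx)

theorem ExtendsAlong.smul_image {ι : Hom Γ A B} {g : Aut Γ B} {p : PartialAut Γ A}
    (h : ExtendsAlong ι g p) : g • (ι.toFun '' p.dom.carrier) = ι.toFun '' p.cod.carrier := by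
  ext z
  constructor
  · rintro ⟨_, ⟨x, hx, rfl⟩, rfl⟩
    exact ⟨p.app x hx, p.app_mem x hx, (h.2 x hx).symm⟩
  · rintro ⟨y, hy, rfl⟩
    obtain ⟨x, hx, rfl⟩ := p.exists_app hy
    exact ⟨_, ⟨x, hx, rfl⟩, h.2 x hx⟩

/-- All partial automorphisms of `A` extend along `ι : A → B`, coherently if `coh` holds; the
parameter `coh` lets EPPA and coherent EPPA be treated at once. -/
def HasExtensions (coh : Prop) (ι : Hom Γ A B) : Prop :=
  ∃ φ : PartialAut Γ A → Aut Γ B, (∀ p, ExtendsAlong ι (φ p) p) ∧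
    (coh → ∀ f g h, CoherentTriple f g h → φ h = φ g * φ f)

variable {coh : Prop}

theorem HasExtensions.comp_left {ι : Hom Γ A B} (h : HasExtensions coh ι) {f : Hom Γ B C}
    {Φ : Aut Γ B →* Aut Γ C} (hΦ : ∀ a : Aut Γ B, (Φ a).1.1 * f.lang = f.lang * a.1.1 ∧
      ∀ x : B.V, (Φ a).1.2 (f.toFun x) = f.toFun (a.1.2 x)) : HasExtensions coh (f.comp ι) := by
  obtain ⟨φ, hφ, hcoh⟩ := h
  refine ⟨fun p => Φ (φ p), fun p => ⟨?_, fun x hx => ?_⟩, fun hc f g h hfgh => ?_⟩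
  · change _ * (f.lang * ι.lang) = f.lang * ι.lang * _
    rw [← mul_assoc, (hΦ (φ p)).1, mul_assoc, (hφ p).1, mul_assoc]
  · exact ((hΦ (φ p)).2 _).trans (congrArg f.toFun ((hφ p).2 x hx))
  · exact (congrArg Φ (hcoh hc f g h hfgh)).trans (map_mul Φ _ _)

/-- The pullback of a partial automorphism along an isomorphism. -/
noncomputable def PartialAut.pullback (e : Hom Γ A B) (he : e.IsIsomorphism)
    (q : PartialAut Γ B) : PartialAut Γ A where
  dom := e.comap q.dom
  cod := e.comap q.cod
  hom := (((e.inverse he).comp (q.cod.incl Γ)).codRestrict (e.comap q.cod) fun x => by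
      change e.toFun ((e.inverse he).toFun x.1) ∈ q.cod.carrier
      rw [e.apply_inverse_apply]
      exact x.2).comp
    (q.hom.comp ((e.comp ((e.comap q.dom).incl Γ)).codRestrict q.dom fun x => x.2))
  isIso :=
    { toIsEmbedding := ((he.inverse.comp q.cod.incl_isEmbedding).codRestrict _ _).comp
        (q.isIso.comp ((he.comp (e.comap q.dom).incl_isEmbedding).codRestrict _ _))
      surjective := by
        rintro ⟨y, hy⟩
        obtain ⟨x, hx, hxy⟩ := q.exists_app hy
        obtain ⟨x, rfl⟩ := he.surjective x
        refine ⟨⟨x, hx⟩, Subtype.ext ?_⟩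
        change (e.inverse he).toFun (q.app (e.toFun x) hx) = y
        rw [hxy, e.inverse_apply_apply] }

theorem PartialAut.apply_pullback_app {e : Hom Γ A B} (he : e.IsIsomorphism) (q : PartialAut Γ B)
    (x : A.V) (hx : x ∈ (q.pullback e he).dom.carrier) :
    e.toFun ((q.pullback e he).app x hx) = q.app (e.toFun x) hx :=
  e.apply_inverse_apply he _

theorem PartialAut.pullback_lang {e : Hom Γ A B} (he : e.IsIsomorphism) (q : PartialAut Γ B) :
    (q.pullback e he).hom.lang = e.lang⁻¹ * q.hom.lang * e.lang := by
  change e.lang⁻¹ * 1 * (q.hom.lang * (e.lang * 1)) = _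
  group

theorem CoherentTriple.pullback {e : Hom Γ A B} (he : e.IsIsomorphism) {f g h : PartialAut Γ B}
    (hfgh : CoherentTriple f g h) :
    CoherentTriple (f.pullback e he) (g.pullback e he) (h.pullback e he) := by
  obtain ⟨hdom, hcod, hlang, hmid, happ⟩ := hfgh
  refine ⟨congrArg e.comap hdom, congrArg e.comap hcod, ?_, congrArg e.comap hmid,
    fun x hf hh => he.injective ?_⟩
  · simp only [PartialAut.pullback_lang, hlang]
    group
  · rw [PartialAut.apply_pullback_app, PartialAut.apply_pullback_app, happ (e.toFun x) hf hh]
    congr 1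
    exact (PartialAut.apply_pullback_app he f x hf).symm

theorem HasExtensions.of_comp_right {η : Hom Γ B C} {e : Hom Γ A B}
    (h : HasExtensions coh (η.comp e)) (he : e.IsIsomorphism) : HasExtensions coh η := by
  obtain ⟨φ, hφ, hcoh⟩ := h
  refine ⟨fun q => φ (q.pullback e he), fun q => ⟨?_, fun y hy => ?_⟩,
    fun hc f g h hfgh => hcoh hc _ _ _ (hfgh.pullback he)⟩
  · have hlang := (hφ (q.pullback e he)).1
    rw [PartialAut.pullback_lang] at hlang
    change _ * (η.lang * e.lang) = η.lang * e.lang * (e.lang⁻¹ * q.hom.lang * e.lang) at hlang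
    refine mul_right_cancel (b := e.lang) ((mul_assoc _ _ _).trans (hlang.trans ?_))
    group
  · obtain ⟨x, rfl⟩ := he.surjective y
    exact ((hφ (q.pullback e he)).2 x hy).trans
      (congrArg η.toFun (PartialAut.apply_pullback_app he q x hy))

theorem hasExtensions_incl_image_iff {ψ : Hom Γ A B} (hψ : ψ.IsEmbedding) :
    HasExtensions coh ((ψ.image hψ).incl Γ) ↔ HasExtensions coh ψ := by
  have he := ψ.toImage_isIsomorphism hψ
  have incl_comp_toImage : ((ψ.image hψ).incl Γ).comp (ψ.toImage hψ) = ψ :=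
    Hom.ext (one_mul _) rfl
  refine ⟨fun h => ?_, fun h => ?_⟩
  · rw [← ψ.comp_inverse_toImage hψ] at h
    exact h.of_comp_right he.inverse
  · rw [← incl_comp_toImage] at h
    exact h.of_comp_right he

theorem extendsAlong_incl_iff {S : Substruc B} {g : Aut Γ B} {p : PartialAut Γ S.toStruc} :
    ExtendsAlong (S.incl Γ) g p ↔ Extends g p :=
  and_congr_left' (by rw [Substruc.incl, mul_one, one_mul])

theorem isEPPAWitness_iff :
    IsEPPAWitness Γ A B ↔ ∃ ψ : Hom Γ A B, ψ.IsEmbedding ∧ HasExtensions False ψ := by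
  refine exists_congr fun ψ => (exists_congr fun hψ => ?_).trans exists_prop
  rw [← hasExtensions_incl_image_iff hψ, Classical.skolem]
  simp only [HasExtensions, extendsAlong_incl_iff, false_imp_iff, and_true]

theorem isCoherentEPPAWitness_iff :
    IsCoherentEPPAWitness Γ A B ↔ ∃ ψ : Hom Γ A B, ψ.IsEmbedding ∧ HasExtensions True ψ := by
  refine exists_congr fun ψ => (exists_congr fun hψ => ?_).trans exists_prop
  rw [← hasExtensions_incl_image_iff hψ]
  simp only [HasExtensions, extendsAlong_incl_iff, true_imp_iff]

end Extensions

section Charts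

/-- The charts on `B`: the substructures that embed in `A`. -/
def charts (Γ : Subgroup L.SymPerm) (A B : Struc.{u, v, w} L) :
    SubMulAction (Aut Γ B) (Substruc B) where
  carrier := {S | ∃ f : Hom Γ S.toStruc A, f.IsEmbedding}
  smul_mem' := fun g S ⟨_, hf⟩ =>
    have ⟨_, he⟩ := Aut.exists_embedding_smul g S
    ⟨_, hf.comp he⟩

/-- The charts on `B` as a family of substructures. -/
abbrev chartFamily (Γ : Subgroup L.SymPerm) (A B : Struc.{u, v, w} L) :
    charts Γ A B → Substruc B :=
  Subtype.val

noncomputable instance [Finite B.V] : Fintype (charts Γ A B) :=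
  Fintype.ofFinite _

noncomputable instance : DecidableEq (charts Γ A B) :=
  Classical.decEq _

instance : EquivariantFamily (Aut Γ B) (carriers (chartFamily Γ A B)) where
  smul_mem_smul_iff _ _ _ := Set.smul_mem_smul_set_iff

theorem mem_charts_of_subset {S T : Substruc B} (hT : T ∈ charts Γ A B)
    (h : S.carrier ⊆ T.carrier) : S ∈ charts Γ A B :=
  have ⟨_, hf⟩ := hT
  ⟨_, hf.comp (S.incl_isEmbedding.codRestrict T fun x => h x.2)⟩

theorem hasHulls_charts : HasHulls (carriers (chartFamily Γ A B)) := fun Q T hQ =>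
  let hull : Substruc B :=
    { carrier := {x | ∀ S : Substruc B, Q ⊆ S.carrier → x ∈ S.carrier}
      closed := fun F x hx _ hy S hS => S.closed F x (hx S hS) hy }
  ⟨⟨hull, mem_charts_of_subset T.2 fun _ hx => hx T.1 hQ⟩, fun _ hx _ hS => hS hx,
    fun T' hT' _ hx => hx T'.1 hT'⟩

/-- The substructure on all vertices. -/
instance : Top (Substruc A) :=
  ⟨{ carrier := Set.univ, closed := fun _ _ _ => Set.subset_univ _ }⟩

/-- The image of a substructure under an embedding. -/
def Hom.map (f : Hom Γ A B) (hf : f.IsEmbedding) (S : Substruc A) : Substruc B where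
  carrier := f.toFun '' S.carrier
  closed := by
    rw [Set.image_eq_range]
    exact ((f.comp (S.incl Γ)).image (hf.comp S.incl_isEmbedding)).closed

/-- The image of a substructure of `A` in `B`, as a chart. -/
def imageChart (ι : Hom Γ A B) (hι : ι.IsEmbedding) (S : Substruc A) : charts Γ A B :=
  ⟨ι.map hι S, _, (ι.toImage_isIsomorphism hι).inverse.toIsEmbedding.comp <|
    (ι.map hι S).incl_isEmbedding.codRestrict (ι.image hι) fun y =>
      Set.image_subset_range ι.toFun S.carrier y.2⟩

theorem ExtendsAlong.smul_imageChart {ι : Hom Γ A B} (hι : ι.IsEmbedding) {g : Aut Γ B}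
    {p : PartialAut Γ A} (h : ExtendsAlong ι g p) :
    g • imageChart ι hι p.dom = imageChart ι hι p.cod :=
  Subtype.ext (Substruc.carrier_injective h.smul_image)

variable [Finite B.V]

/-- The cover of `B` by the charts, based at the image of `A`. -/
noncomputable abbrev chartCover (ι : Hom Γ A B) (hι : ι.IsEmbedding) : Struc.{u, v, w} L :=
  coverStruc (chartFamily Γ A B) (imageChart ι hι ⊤)

/-- The embedding of `A` in the base sheet of the cover. -/
noncomputable def baseLift (ι : Hom Γ A B) (hι : ι.IsEmbedding) :
    Hom Γ A (chartCover ι hι) where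
  lang := ι.lang
  toFun x := (baseSheet _ _).lift (x := ι.toFun x) ⟨x, trivial, rfl⟩
  map_rel R x hx := ⟨ι.map_rel R x hx, baseSheet _ _, fun _ => Sheet.lift_mem_points _ _⟩
  map_fn := by
    rintro F x _ ⟨y, hy, rfl⟩
    exact (Sheet.mem_fn_iff (Sheet.lift_mem_points _ _)).2
      ⟨ι.map_fn F x ⟨y, hy, rfl⟩, Sheet.lift_mem_points _ _⟩

theorem baseLift_mem_points {ι : Hom Γ A B} (hι : ι.IsEmbedding) (x : A.V) :
    (baseLift ι hι).toFun x ∈ (baseSheet _ _).points :=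
  ⟨⟨x, trivial, rfl⟩, rfl⟩

theorem baseLift_isEmbedding {ι : Hom Γ A B} (hι : ι.IsEmbedding) :
    (baseLift ι hι).IsEmbedding where
  injective _ _ hxy := hι.injective (congrArg Cover.pt hxy)
  rel_iff R x := ⟨(baseLift ι hι).map_rel R x, fun h => (hι.rel_iff R x).2 h.1⟩
  fn_eq F x := by
    refine ((baseLift ι hι).map_fn F x).antisymm fun v hv => ?_
    obtain ⟨hv, hvK⟩ := (Sheet.mem_fn_iff (baseLift_mem_points hι x)).1 hv
    obtain ⟨y, hy, hyv⟩ := (hι.fn_eq F x).superset hv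
    exact ⟨y, hy, (baseSheet _ _).injOn_pt (baseLift_mem_points hι y) hvK hyv⟩

variable {ι : Hom Γ A B} {hι : ι.IsEmbedding}

/-- The lift of an extension `g` of `p` that follows the bridge at the range of `p`: its flow
vanishes outside that row, so the base sheet is moved along `p`. -/
noncomputable def ExtendsAlong.lift (hι : ι.IsEmbedding) {g : Aut Γ B} {p : PartialAut Γ A}
    (h : ExtendsAlong ι g p) :
    Lift (Aut Γ B) (carriers (chartFamily Γ A B)) (imageChart ι hι ⊤) where
  base := g
  shift := bridge (imageChart ι hι p.cod) (imageChart ι hι ⊤) (g • imageChart ι hι ⊤)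
  isFlow := isFlow_bridge (Set.image_mono (Set.subset_univ _)) <|
    h.smul_image.superset.trans (Set.smul_set_mono (Set.image_mono (Set.subset_univ _)))

theorem ExtendsAlong.liftAut {g : Aut Γ B} {p : PartialAut Γ A} (h : ExtendsAlong ι g p) :
    ExtendsAlong (baseLift ι hι) (liftAut (h.lift hι)) p := by
  refine ⟨h.1, fun x hx => Cover.ext (h.2 x hx) ?_⟩
  refine (offStar_add_translate (h.lift hι) (ι.toFun x) 0).trans ?_
  rw [map_zero, add_zero]
  change offStar _ (g • ι.toFun x) _ = offStar _ (ι.toFun (p.app x hx)) 0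
  rw [h.2 x hx, offStar_eq_offStar_iff]
  intro D hD
  have hne : D ≠ imageChart ι hι p.cod := fun h => hD (h ▸ ⟨_, p.app_mem x hx, rfl⟩)
  exact Pi.single_eq_of_ne hne _

theorem CoherentTriple.lift_eq {f g h : PartialAut Γ A} (hfgh : CoherentTriple f g h)
    {φ : PartialAut Γ A → Aut Γ B} (hφ : ∀ p, ExtendsAlong ι (φ p) p) (hmul : φ h = φ g * φ f) :
    (hφ h).lift hι = (hφ g).lift hι * (hφ f).lift hι := by
  obtain ⟨-, hcod, -, hmid, -⟩ := hfgh
  refine Lift.ext hmul ?_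
  change bridge (imageChart ι hι h.cod) _ _ =
    bridge (imageChart ι hι g.cod) _ _ + translate (φ g) (bridge (imageChart ι hι f.cod) _ _)
  rw [translate_bridge, hmid, (hφ g).smul_imageChart, bridge_add_bridge, hcod, hmul, mul_smul]

theorem HasExtensions.baseLift {coh : Prop} (h : HasExtensions coh ι) :
    HasExtensions coh (baseLift ι hι) := by
  obtain ⟨φ, hφ, hcoh⟩ := h
  refine ⟨fun p => liftAut ((hφ p).lift hι), fun p => (hφ p).liftAut, fun hc f g h hfgh => ?_⟩
  exact (congrArg GammaL.liftAut (hfgh.lift_eq hφ (hcoh hc f g h hfgh))).trans (map_mul _ _ _)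

theorem IsIrreducible.exists_embedding_of_chartCover {W : Substruc (chartCover ι hι)}
    (hW : IsIrreducible W.toStruc) : ∃ f : Hom Γ W.toStruc A, f.IsEmbedding := by
  obtain ⟨K, hK⟩ := hW.exists_sheet hasHulls_charts
  obtain ⟨e, he⟩ := K.exists_embedding (W.incl_isEmbedding (Γ := Γ)) fun x => hK x.2
  obtain ⟨f, hf⟩ := K.base.2
  exact ⟨f.comp e, hf.comp he⟩

end Charts

section Completable

variable {K E : Set (Struc.{u, v, w} L)} {coh : Prop}

/-- Every finite structure with a homomorphism-embedding to `B` of defect less than `k` has a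
completion in `K`. -/
def CompletableBelow (Γ : Subgroup L.SymPerm) (K : Set (Struc.{u, v, w} L)) (B : Struc.{u, v, w} L)
    (k : ℕ) : Prop :=
  ∀ X : Struc.{u, v, w} L, Finite X.V → ∀ j : Hom Γ X B, j.IsHomEmbedding → j.defect < k →
    HasCompletion Γ K X

/-- Either the image of `X` in the cover is reflecting, or two of its points become linked in `B`,
which lowers the defect. -/
theorem CompletableBelow.chartCover [Finite B.V] (hher : IsHereditary Γ K)
    (hamalg : HasAmalgamation Γ K) (hirr : ∀ A ∈ K, IsIrreducible A) (hA : A ∈ K)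
    {ι : Hom Γ A B} (hι : ι.IsEmbedding) {k : ℕ} (hB : CompletableBelow Γ K B k) :
    CompletableBelow Γ K (chartCover ι hι) (k + 1) := by
  intro X hX j hj hdefect
  have chart_mem (T : charts Γ A B) : T.1.toStruc ∈ K := hher A hA _ T.2
  have hproj : (coverProj Γ (chartFamily Γ A B) (imageChart ι hι ⊤)).IsHomEmbedding :=
    coverProj_isHomEmbedding hasHulls_charts
  by_cases hrefl : IsReflecting (Set.range j.toFun)
  · exact (hrefl.hasCompletion (C := hj.range) hher hamalg hirr hasHulls_charts chart_mem).of_hom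
      (hj.codRestrict hj.range fun x => ⟨x, rfl⟩)
  unfold IsReflecting at hrefl
  push Not at hrefl
  obtain ⟨_, ⟨x, rfl⟩, _, ⟨y, rfl⟩, T, hxT, hyT, hxy⟩ := hrefl
  have linked_proj : Linked (j.toFun x).pt (j.toFun y).pt :=
    ⟨T.1, hirr _ (chart_mem T), hxT, hyT⟩
  have not_linked : ¬ Linked (j.toFun x) (j.toFun y) := fun ⟨W, hW, hxW, hyW⟩ =>
    have ⟨S, hS⟩ := hW.exists_sheet hasHulls_charts
    hxy ⟨S, hS hxW, hS hyW⟩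
  exact hB X hX _ (hproj.comp hj) <|
    (Hom.defect_comp_lt hproj not_linked linked_proj).trans_le (Nat.lt_succ_iff.1 hdefect)

theorem HasExtensions.exists_completableBelow [Finite B.V] (hher : IsHereditary Γ K)
    (hamalg : HasAmalgamation Γ K) (hirr : ∀ A ∈ K, IsIrreducible A) (hA : A ∈ K)
    {ι : Hom Γ A B} (hι : ι.IsEmbedding) (hext : HasExtensions coh ι) (k : ℕ) :
    ∃ B' : Struc.{u, v, w} L, Finite B'.V ∧
      (∃ ι' : Hom Γ A B', ι'.IsEmbedding ∧ HasExtensions coh ι') ∧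
      (∃ π : Hom Γ B' B, π.IsHomEmbedding) ∧ CompletableBelow Γ K B' k := by
  induction k with
  | zero =>
    exact ⟨B, ‹_›, ⟨ι, hι, hext⟩, ⟨_, (Aut.toHom_isEmbedding 1).isHomEmbedding⟩,
      fun _ _ _ _ h => absurd h (Nat.not_lt_zero _)⟩
  | succ k ih =>
    obtain ⟨B', _, ⟨ι', hι', hext'⟩, ⟨π, hπ⟩, hB'⟩ := ih
    exact ⟨GammaL.chartCover ι' hι', inferInstance,
      ⟨_, baseLift_isEmbedding hι', hext'.baseLift⟩,
      ⟨_, hπ.comp (coverProj_isHomEmbedding hasHulls_charts)⟩,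
      hB'.chartCover hher hamalg hirr hA hι'⟩

theorem CompletableBelow.hasCompletion_substruc [Finite B.V] {n : ℕ}
    (hB : CompletableBelow Γ K B (n ^ 2 + 1)) {S : Substruc B} (hS : S.carrier.ncard ≤ n) :
    HasCompletion Γ K S.toStruc :=
  hB S.toStruc inferInstance _
    (S.incl_isEmbedding (Γ := Γ)).isHomEmbedding <|
    Nat.lt_succ_iff.2 <| (S.incl Γ).defect_le.trans (Nat.pow_le_pow_left hS 2)

theorem IsLocallyFiniteAutPreserving.exists_hasExtensions [Finite B.V]
    (hloc : IsLocallyFiniteAutPreserving Γ K E) (hher : IsHereditary Γ K)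
    (hamalg : HasAmalgamation Γ K) (hirr : ∀ A ∈ K, IsIrreducible A) (hA : A ∈ K) (hB : B ∈ E)
    (hAB : ∃ ι : Hom Γ A B, ι.IsEmbedding ∧ HasExtensions coh ι) :
    ∃ C ∈ K, ∃ ψ : Hom Γ A C, ψ.IsEmbedding ∧ HasExtensions coh ψ := by
  obtain ⟨ι, hι, hext⟩ := hAB
  obtain ⟨n, hn⟩ := hloc.2 A hA B hB
  obtain ⟨B', _, ⟨ι', hι', hext'⟩, ⟨π, hπ⟩, hB'⟩ :=
    hext.exists_completableBelow hher hamalg hirr hA hι (n ^ 2)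
  obtain ⟨C, hC, -, f, hf, -, Φ, hΦ⟩ := hn (chartCover ι' hι') inferInstance
    (fun _ => IsIrreducible.exists_embedding_of_chartCover)
    ⟨_, hπ.comp (coverProj_isHomEmbedding hasHulls_charts)⟩
    fun _ => (hB'.chartCover hher hamalg hirr hA hι').hasCompletion_substruc
  exact ⟨C, hC, f.comp (baseLift ι' hι'),
    hf.comp_isEmbedding (baseLift_isEmbedding hι') (hirr A hA), hext'.baseLift.comp_left hΦ⟩

end Completable

end GammaL

theorem theorem1p6 {L : GammaL.Lang.{u, v}} (Γ : Subgroup L.SymPerm)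
    (E K : Set (GammaL.Struc.{u, v, w} L))
    (hEfin : ∀ A ∈ E, Finite A.V)
    (hE : GammaL.HasEPPA Γ E)
    (hKirr : ∀ A ∈ K, GammaL.IsIrreducible A)
    (hKher : GammaL.IsHereditary Γ K)
    (hKamalg : GammaL.HasAmalgamation Γ K)
    (hKloc : GammaL.IsLocallyFiniteAutPreserving Γ K E) :
    GammaL.HasEPPA Γ K ∧
      (GammaL.HasCoherentEPPA Γ E → GammaL.HasCoherentEPPA Γ K) := by
  constructor
  · intro A hA
    obtain ⟨B, hB, hAB⟩ := hE A (hKloc.1 hA)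
    have := hEfin B hB
    obtain ⟨C, hC, hAC⟩ := hKloc.exists_hasExtensions hKher hKamalg hKirr hA hB
      (GammaL.isEPPAWitness_iff.1 hAB)
    exact ⟨C, hC, GammaL.isEPPAWitness_iff.2 hAC⟩
  · intro hEcoh A hA
    obtain ⟨B, hB, hAB⟩ := hEcoh A (hKloc.1 hA)
    have := hEfin B hB
    obtain ⟨C, hC, hAC⟩ := hKloc.exists_hasExtensions hKher hKamalg hKirr hA hB
      (GammaL.isCoherentEPPAWitness_iff.1 hAB)
    exact ⟨C, hC, GammaL.isCoherentEPPAWitness_iff.2 hAC⟩
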